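/- A repetition in a finite word $x$ is a pair of words $p,e$ such that $pe$ is a factor (block of consecutive letters) of $x$, $p$ is non-empty, and $e$ is a prefix of $pe$; its exponent is $|pe|/|p|$. For a real number $r$, a finite word is $r^+$-free if it contains no repetition of exponent strictly greater than $r$. For an infinite word $w$ and an integer $i\ge 1$, let $\mathrm{pexp}_i(w)$ be the smallest real number $r$ such that every product (concatenation) of $i$ factors of $w$ is $r^+$-free (if such an $r$ exists). The generalized repetition threshold $\mathrm{RT}_i(k)$ is the minimum of $\mathrm{pexp}_i(w)$ over all infinite words $w$ over a $k$-letter alphabet. Theorem. For every integer $i\ge 1$, the minimum $\mathrm{RT}_i(3)$ exists, and \begin{itemize} \item $\mathrm{RT}_i(3)=\tfrac{3i}{2}+\tfrac14$ if $i=1$ or $i$ is even; \item $\mathrm{RT}_i(3)=\tfrac{3i}{2}+\tfrac16$ if $i$ is odd and $i\ge 3$. \end{itemize} -/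

import Mathlib

/-- The finite word `u` is a factor (a block of consecutive letters, possibly empty) of the infinite
word `w`. -/
def IsFactor {α : Type} (w : ℕ → α) (u : List α) : Prop :=
  ∃ n m : ℕ, u = (List.range m).map (fun j => w (n + j))

/-- The finite word `x` is a product (concatenation) of `i` factors of the infinite word `w`.
The factors may occur anywhere in `w`: they may overlap and may be used several times. -/
def IsProductOfFactors {α : Type} (i : ℕ) (w : ℕ → α) (x : List α) : Prop :=
  ∃ l : List (List α), l.length = i ∧ (∀ u ∈ l, IsFactor w u) ∧ x = l.flatten

/-- `(p, e)` is a repetition in the finite word `x`: `pe` is a factor of `x`, `p` is non-empty and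
`e` is a prefix of `pe`. -/
def IsRepetitionIn {α : Type} (x p e : List α) : Prop :=
  (p ++ e) <:+: x ∧ p ≠ [] ∧ e <+: (p ++ e)

/-- The exponent `|pe| / |p|` of a repetition `(p, e)`. -/
noncomputable def repExponent {α : Type} (p e : List α) : ℝ :=
  ((p ++ e).length : ℝ) / (p.length : ℝ)

/-- The finite word `x` is `r⁺`-free: it contains no repetition of exponent `> r`. -/
def IsPlusFree {α : Type} (r : ℝ) (x : List α) : Prop :=
  ∀ p e : List α, IsRepetitionIn x p e → ¬ r < repExponent p e

/-- `pexp_i(w) = r`: `r` is the smallest real number such that every product of `i` factors of `w`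
is `r⁺`-free. (No real `r` satisfies this if the exponents are unbounded.) -/
def IsPexp {α : Type} (i : ℕ) (w : ℕ → α) (r : ℝ) : Prop :=
  IsLeast {s : ℝ | ∀ x : List α, IsProductOfFactors i w x → IsPlusFree s x} r

/-- `RT_i(k) = r`: `r` is the minimum of `pexp_i(w)` over the infinite words `w` on `k` letters. -/
def IsRT (i k : ℕ) (r : ℝ) : Prop :=
  IsLeast {s : ℝ | ∃ w : ℕ → Fin k, IsPexp i w s} r

/-!
A repetition with period `P` in a product of `i` factors of `w` is a chain of `i` consecutive
blocks of a `P`-periodic word `u`, all of which are factors of `w` (`Chain`). So the theorem is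
about the total length of such chains, compared with `P`.

*Lower bounds.* Every ternary word `w` has a factor of exponent at least `7/4` (`HasRun`), a
product of two factors of exponent at least `13/4` (`HasPair`), and two factors `x`, `y` such that
`xyx` has a period `P` with `|xy| = 3P` and `|x| ≥ 5P/3` (`HasSandwich`). Blocks of total length
`3P` can be repeated, two at a time, along the periodic word. So a pair gives exponents `13/4 +
3k` for `2k + 2` factors (`HasPair.le`), and a sandwich gives `5/3 + 3k` for `2k + 1` factors
(`HasSandwich.le`); these are the values of the theorem. The three configurations are found by
exhaustive search: extend a word letter by letter; whenever it ends with a run `x` of period `p`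
longer than `3p/2`, the words that would complete `x` to the desired configuration must not be
factors of the whole infinite word, so they are forbidden in the rest of the branch. All branches
end (`search_sound`, `hasRun_ternary`, `hasPair_ternary`, `hasSandwich_ternary`). The search is
carried out by the kernel, on words coded by numbers.

*Upper bounds.* For one factor the word is an automatic word with runs bounded by Dejean's
exponent `7/4` (`dejeanWord_run_le`). For more factors, the words consist of seven blocks of
length `190` (for even `i`) or `386` (for odd `i`), which are substituted for the letters of an
automatic word `sourceWord` on seven letters. In the latter, a run of length `l` beyond its period
`p` satisfies `2l + 1 ≤ p` (`sourceWord_run_lt`). Long windows determine their position modulo the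
length of the blocks (`Coded.synchronized`), and two different blocks agree on at most a quarter
of a block at a time, so the factors of exponent greater than `3/2` of the substituted words have
short periods. All short factors occur near the beginning of the words, so a finite computation
finds those of exponent greater than `3/2` and period less than the double length of a
synchronizing window: they belong to a short list of periodic words, with bounds for their lengths
(`classified_blockWord`). If a chain contains such a factor, then it runs along one of these
periodic words. The long factors of such a word end at few places of the period, where only
shorter ones begin, and this is expressed by a potential on the places: two consecutive factors
have total length at most `3P` up to a change of the potential (`Classified.two_mul_sum_le`), and
the potential costs at most `P/4` in total for even `i`, while for odd `i` three consecutive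
factors have at most the length `14P/3`. If there is no such factor, all the blocks have length at
most `3P/2`.

The finite computations use sets of positions, coded by the binary digits of numbers, and
synchronization and the absence of runs are read off from bitwise operations on them.
-/

/-! ### Segments of a periodic word -/

/-- The block of length `d` starting at position `s` of the word `u` is a factor of `w`. -/
def Seg {α : Type} (w u : ℕ → α) (s d : ℕ) : Prop :=
  ∃ n, ∀ j < d, w (n + j) = u (s + j)

/-- Consecutive blocks of `u`, of the lengths listed in `ds` and starting at position `s`, are all
factors of `w`. -/
def Chain {α : Type} (w u : ℕ → α) : ℕ → List ℕ → Prop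
  | _, [] => True
  | s, d :: ds => Seg w u s d ∧ Chain w u (s + d) ds

section Chains

variable {α : Type} {w u : ℕ → α}

theorem Seg.shift {s d P : ℕ} (h : Seg w u s d) (hu : ∀ j, u (j + P) = u j) (k : ℕ) :
    Seg w u (s + k * P) d := by
  have hk : ∀ k j, u (j + k * P) = u j := by
    intro k
    induction k with
    | zero => simp
    | succ k ih =>
      intro j
      rw [Nat.succ_mul, ← Nat.add_assoc, hu, ih]
  obtain ⟨n, hn⟩ := h
  refine ⟨n, fun j hj => ?_⟩
  rw [hn j hj, Nat.add_right_comm, hk]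

theorem Seg.sub {s d k e : ℕ} (h : Seg w u s d) (hk : k + e ≤ d) : Seg w u (s + k) e := by
  obtain ⟨n, hn⟩ := h
  refine ⟨n + k, fun j hj => ?_⟩
  rw [Nat.add_assoc, hn (k + j) (by omega), Nat.add_assoc]

theorem chain_append {s : ℕ} {l₁ l₂ : List ℕ} :
    Chain w u s (l₁ ++ l₂) ↔ Chain w u s l₁ ∧ Chain w u (s + l₁.sum) l₂ := by
  induction l₁ generalizing s with
  | nil => simp [Chain]
  | cons d l ih => simp [Chain, ih, and_assoc, Nat.add_assoc]

theorem Chain.shift {P : ℕ} (hu : ∀ j, u (j + P) = u j) (k : ℕ) {l : List ℕ} {s : ℕ}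
    (h : Chain w u s l) : Chain w u (s + k * P) l := by
  induction l generalizing s with
  | nil => trivial
  | cons d l ih =>
    refine ⟨h.1.shift hu k, ?_⟩
    have := ih h.2
    rwa [Nat.add_right_comm] at this

/-- A chain whose total length is a multiple of the period can be repeated. -/
theorem Chain.repeat {P m : ℕ} (hu : ∀ j, u (j + P) = u j) {l : List ℕ} {s : ℕ}
    (h : Chain w u s l) (hl : l.sum = m * P) (k : ℕ) :
    Chain w u s (List.replicate k l).flatten := by
  induction k generalizing s with
  | zero => simp [Chain]
  | succ k ih =>
    rw [List.replicate_succ, List.flatten_cons, chain_append]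
    exact ⟨h, ih (by rw [hl]; exact h.shift hu m)⟩

theorem Seg.isFactor {s d : ℕ} (h : Seg w u s d) :
    IsFactor w ((List.range d).map fun j => u (s + j)) := by
  obtain ⟨n, hn⟩ := h
  refine ⟨n, d, List.map_congr_left fun j hj => ?_⟩
  rw [hn j (List.mem_range.1 hj)]

theorem Chain.isProductOfFactors {s : ℕ} {l : List ℕ} (h : Chain w u s l) :
    IsProductOfFactors l.length w ((List.range l.sum).map fun j => u (s + j)) := by
  induction l generalizing s with
  | nil => exact ⟨[], rfl, by simp, by simp⟩
  | cons d l ih =>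
    obtain ⟨L, h1, h2, h3⟩ := ih h.2
    refine ⟨((List.range d).map fun j => u (s + j)) :: L, by simp [h1], ?_, ?_⟩
    · intro v hv
      rcases List.mem_cons.1 hv with rfl | hv
      · exact h.1.isFactor
      · exact h2 v hv
    · rw [List.flatten_cons, ← h3, List.sum_cons, List.range_add, List.map_append, List.map_map]
      simp [Function.comp_def, Nat.add_assoc]

/-- A chain along a `P`-periodic word gives a repetition of exponent `total length / P`. -/
theorem Chain.le_of_isPlusFree {P : ℕ} (hP : 1 ≤ P) (hu : ∀ j, u (j + P) = u j) {s : ℕ}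
    {l : List ℕ} (h : Chain w u s l) {r : ℝ}
    (hr : ∀ x, IsProductOfFactors l.length w x → IsPlusFree r x) (hl : P ≤ l.sum) :
    (l.sum : ℝ) / P ≤ r := by
  have key := hr _ h.isProductOfFactors ((List.range P).map fun j => u (s + j))
    ((List.range (l.sum - P)).map fun j => u (s + P + j)) ?_
  · rw [not_lt, repExponent] at key
    simpa [Nat.add_sub_cancel' hl] using key
  · have e1 : ((List.range P).map fun j => u (s + j)) ++
        ((List.range (l.sum - P)).map fun j => u (s + P + j)) =
        (List.range l.sum).map fun j => u (s + j) := by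
      conv_rhs => rw [← Nat.add_sub_cancel' hl, List.range_add, List.map_append, List.map_map]
      simp [Function.comp_def, Nat.add_assoc]
    refine ⟨?_, ?_, ?_⟩
    · rw [e1]
    · simp; omega
    · rw [e1]
      have e2 : ((List.range (l.sum - P)).map fun j => u (s + P + j)) =
          (List.range (l.sum - P)).map fun j => u (s + j) := by
        refine List.map_congr_left fun j _ => ?_
        rw [Nat.add_right_comm, hu]
      rw [e2, List.prefix_iff_eq_take, ← List.map_take, List.take_range]
      simp

end Chains

/-! ### Configurations that force large exponents -/

/-- Some factor of `w` has exponent at least `7/4`. -/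
def HasRun {α : Type} (w : ℕ → α) : Prop :=
  ∃ (P : ℕ) (u : ℕ → α) (s a : ℕ), 1 ≤ P ∧ (∀ j, u (j + P) = u j) ∧ Seg w u s a ∧ 7 * P ≤ 4 * a

/-- Some product of two factors of `w` has exponent at least `13/4`. -/
def HasPair {α : Type} (w : ℕ → α) : Prop :=
  ∃ (P : ℕ) (u : ℕ → α) (s a b : ℕ), 1 ≤ P ∧ (∀ j, u (j + P) = u j) ∧
    Seg w u s a ∧ Seg w u (s + a) b ∧ 13 * P ≤ 4 * (a + b)

/-- Two factors `x`, `y` of `w` are such that `xyx` has a period `P` with `|xy| = 3P` and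
`|x| ≥ 5P/3`. -/
def HasSandwich {α : Type} (w : ℕ → α) : Prop :=
  ∃ (P : ℕ) (u : ℕ → α) (s a b : ℕ), 1 ≤ P ∧ (∀ j, u (j + P) = u j) ∧
    Seg w u s a ∧ Seg w u (s + a) b ∧ a + b = 3 * P ∧ 5 * P ≤ 3 * a

section

variable {α : Type} {w : ℕ → α} {r : ℝ}

theorem HasRun.le (h : HasRun w)
    (hr : ∀ x, IsProductOfFactors 1 w x → IsPlusFree r x) : (7 : ℝ) / 4 ≤ r := by
  obtain ⟨P, u, s, a, hP, hu, ha, hl⟩ := h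
  have hc : Chain w u s [a] := ⟨ha, trivial⟩
  refine le_trans ?_ (hc.le_of_isPlusFree hP hu hr (by simp; omega))
  have hP' : (0 : ℝ) < P := by exact_mod_cast hP
  rw [le_div_iff₀ hP', List.sum_singleton]
  have : (7 * P : ℝ) ≤ 4 * a := by exact_mod_cast hl
  linarith

/-- A pair `xy` of exponent at least `13/4` can be continued by blocks `x'y'` of length `3P`, where
`x'` is a suffix of `x` and `y'` a suffix of `y`. -/
theorem HasPair.le (h : HasPair w) {k : ℕ}
    (hr : ∀ x, IsProductOfFactors (2 * k + 2) w x → IsPlusFree r x) :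
    3 * ((2 * k + 2 : ℕ) : ℝ) / 2 + 1 / 4 ≤ r := by
  obtain ⟨P, u, s, a, b, hP, hu, ha, hb, hl⟩ := h
  have hab : ∃ a' b', a' + b' = 3 * P ∧
      Seg w u (s + a + b) a' ∧ Seg w u (s + a + b + a') b' := by
    rcases le_total b (3 * P) with hb3 | hb3
    · refine ⟨3 * P - b, b, by omega, ?_, ?_⟩
      · have h1 : Seg w u (s + (a - (3 * P - b))) (3 * P - b) := ha.sub (by omega)
        have h2 := h1.shift hu 3
        rwa [show s + (a - (3 * P - b)) + 3 * P = s + a + b by omega] at h2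
      · have h2 := hb.shift hu 3
        rwa [show s + a + 3 * P = s + a + b + (3 * P - b) by omega] at h2
    · refine ⟨0, 3 * P, by omega, ⟨0, by simp⟩, ?_⟩
      have h1 : Seg w u (s + a + (b - 3 * P)) (3 * P) := hb.sub (by omega)
      have h2 := h1.shift hu 3
      rwa [show s + a + (b - 3 * P) + 3 * P = s + a + b + 0 by omega] at h2
  obtain ⟨a', b', hs, h1, h2⟩ := hab
  have hrep : Chain w u (s + a + b) (List.replicate k [a', b']).flatten :=
    Chain.repeat (m := 3) hu (l := [a', b']) (show _ ∧ _ ∧ True from ⟨h1, h2, trivial⟩)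
      (by simpa using hs) k
  have hc : Chain w u s (a :: b :: (List.replicate k [a', b']).flatten) := ⟨ha, hb, hrep⟩
  have hlen : (a :: b :: (List.replicate k [a', b']).flatten).length = 2 * k + 2 := by
    simp; ring
  have hsum : (a :: b :: (List.replicate k [a', b']).flatten).sum = a + b + k * (3 * P) := by
    simp [List.sum_flatten, ← hs]; ring
  rw [← hlen] at hr
  refine le_trans ?_ (hc.le_of_isPlusFree hP hu hr (by rw [hsum]; nlinarith [Nat.zero_le (k * P)]))
  have hP' : (0 : ℝ) < P := by exact_mod_cast hP
  rw [le_div_iff₀ hP', hsum]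
  have : (13 * P : ℝ) ≤ 4 * (a + b) := by exact_mod_cast hl
  push_cast
  nlinarith

/-- A sandwich can be continued to `xyxy…xyx`. -/
theorem HasSandwich.le (h : HasSandwich w) {k : ℕ}
    (hr : ∀ x, IsProductOfFactors (2 * k + 1) w x → IsPlusFree r x) :
    3 * ((2 * k + 1 : ℕ) : ℝ) / 2 + 1 / 6 ≤ r := by
  obtain ⟨P, u, s, a, b, hP, hu, ha, hb, hs, hl⟩ := h
  have hrep : Chain w u s (List.replicate k [a, b]).flatten :=
    Chain.repeat (m := 3) hu (l := [a, b]) (show _ ∧ _ ∧ True from ⟨ha, hb, trivial⟩)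
      (by simpa using hs) k
  have hsum : ((List.replicate k [a, b]).flatten).sum = k * (3 * P) := by
    simp [List.sum_flatten, ← hs]
  have hc : Chain w u s ((List.replicate k [a, b]).flatten ++ [a]) := by
    rw [chain_append, hsum]
    refine ⟨hrep, ?_, trivial⟩
    have := ha.shift hu (k * 3)
    rwa [Nat.mul_assoc] at this
  have hlen : ((List.replicate k [a, b]).flatten ++ [a]).length = 2 * k + 1 := by
    simp; ring
  have hsum' : ((List.replicate k [a, b]).flatten ++ [a]).sum = k * (3 * P) + a := by
    rw [List.sum_append, hsum, List.sum_singleton]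
  rw [← hlen] at hr
  refine le_trans ?_
    (hc.le_of_isPlusFree hP hu hr (by rw [hsum']; nlinarith [Nat.zero_le (k * P)]))
  have hP' : (0 : ℝ) < P := by exact_mod_cast hP
  rw [le_div_iff₀ hP', hsum']
  have : (5 * P : ℝ) ≤ 3 * a := by exact_mod_cast hl
  push_cast
  nlinarith

end

/-! ### Words coded by numbers -/

/-- `force n k = k n`, by recursion on `n`, so that evaluating `force n k` in the kernel first
evaluates `n` to a numeral. -/
def force {β : Type} (n : ℕ) (k : ℕ → β) : β :=
  Nat.rec (k 0) (fun m _ => k (Nat.succ m)) n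

@[simp] theorem force_eq {β : Type} (n : ℕ) (k : ℕ → β) : force n k = k n := by
  cases n <;> rfl

/-- The code in base `4` of the block of length `m` at position `n` of a word over `{0, 1, 2}`: the
letter `c` becomes the digit `c + 1`, and the last letter is the least significant digit. -/
def code (v : ℕ → ℕ) (n : ℕ) : ℕ → ℕ
  | 0 => 0
  | m + 1 => 4 * code v n m + (v (n + m) + 1)

theorem code_congr {v v' : ℕ → ℕ} {n n' m : ℕ} (h : ∀ j < m, v (n + j) = v' (n' + j)) :
    code v n m = code v' n' m := by
  induction m with
  | zero => rfl
  | succ m ih => rw [code, code, ih fun j hj => h j (by omega), h m (by omega)]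

theorem code_add (v : ℕ → ℕ) (n a b : ℕ) :
    code v n (a + b) = 4 ^ b * code v n a + code v (n + a) b := by
  induction b with
  | zero => simp [code]
  | succ b ih => rw [← Nat.add_assoc, code, ih, code, pow_succ, Nat.add_assoc n a b]; ring

section Codes

variable {v v' : ℕ → ℕ}

theorem code_lt (hv : ∀ n, v n < 3) (n m : ℕ) : code v n m < 4 ^ m := by
  induction m with
  | zero => simp [code]
  | succ m ih => have := hv (n + m); rw [code, pow_succ]; omega

theorem pow_le_code (v : ℕ → ℕ) (n m : ℕ) : 4 ^ m ≤ 4 * code v n m + 1 := by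
  induction m with
  | zero => simp
  | succ m ih => rw [code, pow_succ]; omega

theorem code_div (hv : ∀ n, v n < 3) (n m k : ℕ) :
    code v n m / 4 ^ k = code v n (m - k) := by
  rcases le_total m k with h | h
  · rw [Nat.sub_eq_zero_of_le h, code, Nat.div_eq_of_lt]
    exact (code_lt hv n m).trans_le (Nat.pow_le_pow_right (by norm_num) h)
  · conv_lhs => rw [← Nat.sub_add_cancel h, code_add]
    rw [Nat.mul_add_div (by positivity), Nat.div_eq_of_lt (code_lt hv _ _), Nat.add_zero]

theorem code_mod (hv : ∀ n, v n < 3) (n m k : ℕ) :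
    code v n m % 4 ^ k = code v (n + (m - k)) (min m k) := by
  rcases le_total m k with h | h
  · rw [Nat.mod_eq_of_lt, Nat.sub_eq_zero_of_le h, min_eq_left h, Nat.add_zero]
    exact (code_lt hv n m).trans_le (Nat.pow_le_pow_right (by norm_num) h)
  · conv_lhs => rw [← Nat.sub_add_cancel h, code_add]
    rw [Nat.mul_add_mod, Nat.mod_eq_of_lt (code_lt hv _ _), min_eq_right h]

theorem code_eq_length (hv : ∀ n, v n < 3) (hv' : ∀ n, v' n < 3) {n m n' m' : ℕ}
    (h : code v n m = code v' n' m') : m = m' := by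
  wlog hlt : m < m' generalizing v v' n m n' m'
  · rcases Nat.lt_or_ge m' m with h2 | h2
    · exact (this hv' hv h.symm h2).symm
    · omega
  exfalso
  have h1 := code_lt hv n m
  have h2 := pow_le_code v' n' m'
  have h3 : 4 ^ (m + 1) ≤ 4 ^ m' := Nat.pow_le_pow_right (by norm_num) hlt
  rw [pow_succ] at h3
  omega

theorem code_injective (hv : ∀ n, v n < 3) (hv' : ∀ n, v' n < 3) {n n' m : ℕ}
    (h : code v n m = code v' n' m) : ∀ j < m, v (n + j) = v' (n' + j) := by
  induction m with
  | zero => simp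
  | succ m ih =>
    have h1 := hv (n + m)
    have h2 := hv' (n' + m)
    simp only [code] at h
    intro j hj
    rcases Nat.lt_succ_iff_lt_or_eq.1 hj with hj | rfl
    · exact ih (by omega) j hj
    · omega

end Codes

/-! ### Exhaustive search in the tree of words -/

/-- The conditional, by recursion on the condition; this and the other recursors in this part keep
the evaluation in the kernel short. -/
def branch (c t e : Bool) : Bool := Bool.rec e t c

theorem branch_eq (c t e : Bool) : branch c t e = if c = true then t else e := by
  cases c <;> rfl

/-- Does some member of the list satisfy `f`? -/
def anyTrue {β : Type} (f : β → Bool) (l : List β) : Bool :=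
  List.rec false (fun a _ ih => branch (f a) true ih) l

theorem exists_of_anyTrue {β : Type} {f : β → Bool} {l : List β} (h : anyTrue f l = true) :
    ∃ a ∈ l, f a = true := by
  induction l with
  | nil => exact absurd h Bool.false_ne_true
  | cons a l ih =>
    cases hf : f a with
    | true => exact ⟨a, List.mem_cons_self, hf⟩
    | false =>
      obtain ⟨b, hb, hb'⟩ := ih (by simpa only [anyTrue, hf, branch] using h)
      exact ⟨b, List.mem_cons_of_mem _ hb, hb'⟩

/-- The test that the word coded by `X` ends with a given word. The latter is represented by its
code `f.1` together with the power `f.2` of `4` whose exponent is its length. -/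
def codeSuffix (X : ℕ) (f : ℕ × ℕ) : Bool := Nat.beq (Nat.mod X f.2) f.1

/-- The test that the last `e` letters of the word coded by `X` occur `p` places earlier. -/
def codeMatch (X p e : ℕ) : Bool :=
  Nat.beq (Nat.mod X (Nat.pow 4 e)) (Nat.mod (Nat.div X (Nat.pow 4 p)) (Nat.pow 4 e))

/-- The largest `e ≤ m` for which `codeMatch X p e` holds, or `0` if there is none. -/
def codeMatchLen (X p : ℕ) : ℕ → ℕ
  | 0 => 0
  | m + 1 => bif codeMatch X p (m + 1) then m + 1 else codeMatchLen X p m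

/-- The code of the block of length `l` of the word `bbbb` which is followed by `o` further letters,
where `b` consists of the last `p` letters of the word coded by `X`. -/
def codeSlice (X p o l : ℕ) : ℕ :=
  Nat.mod (Nat.div (Nat.mul (Nat.mod X (Nat.pow 4 p)) (1 + 4 ^ p + 4 ^ (2 * p) + 4 ^ (3 * p)))
    (Nat.pow 4 o)) (Nat.pow 4 l)

/-- Process the slices `(o, l)` in a list: answer `true` if one of them occurs in the word, at one of
the last `150` positions, and otherwise continue with all of them added to the list of forbidden words. -/
def addSlices (X p : ℕ) (l : List (ℕ × ℕ)) : List (ℕ × ℕ) → (List (ℕ × ℕ) → Bool) → Bool :=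
  List.rec (fun F k => k F) (fun a _ ih F k =>
    force (codeSlice X p a.1 a.2) fun f => force (Nat.pow 4 a.2) fun m =>
      branch (anyTrue (fun j => codeSuffix (Nat.div X (Nat.pow 4 j)) (f, m)) (List.range 150))
        true (ih ((f, m) :: F) k)) l

/-- For each period `p` in a list, find the longest run of period `p` at the end of the current
word. If it is longer than `3p/2`, process the slices that `comps` attaches to it. -/
def addRuns (comps : ℕ → ℕ → List (ℕ × ℕ)) (X : ℕ) (ps : List ℕ) :
    List (ℕ × ℕ) → (List (ℕ × ℕ) → Bool) → Bool :=
  List.rec (fun F k => k F) (fun p _ ih F k =>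
    branch (codeMatch X p (Nat.succ (Nat.div p 2)))
      (force (codeMatchLen X p p) fun e =>
        addSlices X p (comps p (Nat.add p e)) F fun F' => ih F' k)
      (ih F k)) ps

/-- One step of the search: answer `true` if the word coded by `X` ends with a square or a forbidden
word, or contains a word that `comps` attaches to a run at its end; otherwise go on with the enlarged
list of forbidden words. -/
def searchStep (comps : ℕ → ℕ → List (ℕ × ℕ)) (ps : List ℕ) (X : ℕ) (F : List (ℕ × ℕ))
    (k : List (ℕ × ℕ) → Bool) : Bool :=
  branch (anyTrue (fun p => codeMatch X p p) ps) true
    (branch (anyTrue (codeSuffix X) F) true (addRuns comps X ps F k))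

/-- Depth-first search through all the extensions of the word coded by `X`; it answers `true` if all
the branches end within `n` steps. -/
def search (comps : ℕ → ℕ → List (ℕ × ℕ)) (ps : List ℕ) (n : ℕ) : ℕ → List (ℕ × ℕ) → Bool :=
  Nat.rec (fun _ _ => false) (fun _ ih X F =>
    branch (force (Nat.add (Nat.mul 4 X) 1) fun Y => searchStep comps ps Y F (ih Y))
      (branch (force (Nat.add (Nat.mul 4 X) 2) fun Y => searchStep comps ps Y F (ih Y))
        (force (Nat.add (Nat.mul 4 X) 3) fun Y => searchStep comps ps Y F (ih Y)) false) false) n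

/-- The search restricted to the words that begin with the given letters. -/
def searchFrom (comps : ℕ → ℕ → List (ℕ × ℕ)) (ps : List ℕ) (n : ℕ) :
    List ℕ → ℕ → List (ℕ × ℕ) → Bool
  | [], X, F => search comps ps n X F
  | c :: y, X, F => force (Nat.add (Nat.mul 4 X) (Nat.succ c)) fun Y =>
      searchStep comps ps Y F fun F' => searchFrom comps ps n y Y F'

theorem addSlices_cons (X p : ℕ) (a : ℕ × ℕ) (l F : List (ℕ × ℕ)) (k : List (ℕ × ℕ) → Bool) :
    addSlices X p (a :: l) F k =
      if anyTrue (fun j => codeSuffix (X / 4 ^ j) (codeSlice X p a.1 a.2, 4 ^ a.2))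
        (List.range 150) = true then true
      else addSlices X p l ((codeSlice X p a.1 a.2, 4 ^ a.2) :: F) k := by
  simp only [addSlices, force_eq, branch_eq]
  rfl

theorem addRuns_cons (comps : ℕ → ℕ → List (ℕ × ℕ)) (X p : ℕ) (ps : List ℕ) (F : List (ℕ × ℕ))
    (k : List (ℕ × ℕ) → Bool) :
    addRuns comps X (p :: ps) F k =
      if codeMatch X p (p / 2 + 1) = true then
        addSlices X p (comps p (p + codeMatchLen X p p)) F fun F' => addRuns comps X ps F' k
      else addRuns comps X ps F k := by
  simp only [addRuns, force_eq, branch_eq]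
  rfl

theorem search_succ (comps : ℕ → ℕ → List (ℕ × ℕ)) (ps : List ℕ) (n X : ℕ) (F : List (ℕ × ℕ)) :
    search comps ps (n + 1) X F = true ↔
      ∀ c ∈ [1, 2, 3], searchStep comps ps (4 * X + c) F (search comps ps n (4 * X + c)) = true := by
  simp only [search, force_eq, branch_eq]
  simp

/-! ### Soundness of the search -/

/-- If the word represented by `f` is a factor of `v`, then `v` has the property `G`. -/
def Forbidden (G : Prop) (v : ℕ → ℕ) (f : ℕ × ℕ) : Prop :=
  ∃ (u : ℕ → ℕ) (s l : ℕ), (∀ j, u j < 3) ∧ f = (code u s l, 4 ^ l) ∧ (Seg v u s l → G)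

/-- What the search needs to know about the slices that `comps` attaches to runs: if a word contains
a run of length `a` and period `p` as well as one of these slices, then it has the property `G`. -/
def SoundComps (G : Prop) (v : ℕ → ℕ) (comps : ℕ → ℕ → List (ℕ × ℕ)) : Prop :=
  ∀ p a, 1 ≤ p → a ≤ 2 * p → ∀ o l, (o, l) ∈ comps p a → o + l ≤ 4 * p ∧
    ∀ u : ℕ → ℕ, (∀ j, u (j + p) = u j) → Seg v u (4 * p - a) a → Seg v u (4 * p - o - l) l → G

section Soundness

variable {G : Prop} {v : ℕ → ℕ} {comps : ℕ → ℕ → List (ℕ × ℕ)}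

theorem Forbidden.of_codeSuffix {f : ℕ × ℕ} (hv : ∀ n, v n < 3) (hf : Forbidden G v f) {n m : ℕ}
    (h : codeSuffix (code v n m) f = true) : G := by
  obtain ⟨u, s, l, hu, rfl, hG⟩ := hf
  have h := Nat.eq_of_beq_eq_true h
  change code v n m % 4 ^ l = code u s l at h
  rw [code_mod hv] at h
  have hl := code_eq_length hv hu h
  rw [hl] at h
  exact hG ⟨_, code_injective hv hu h⟩

/-- The letters of a code are nonzero digits, so `codeMatch` fails when it would have to look beyond
the beginning of the word. -/
theorem codeMatch_spec (hv : ∀ n, v n < 3) {n m p e : ℕ} (hp : 1 ≤ p) (hm : 1 ≤ m)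
    (he : 1 ≤ e) (h : codeMatch (code v n m) p e = true) :
    p + e ≤ m ∧ ∀ j < e, v (n + (m - p - e) + j) = v (n + (m - e) + j) := by
  have h := Nat.eq_of_beq_eq_true h
  change code v n m % 4 ^ e = code v n m / 4 ^ p % 4 ^ e at h
  rw [code_div hv, code_mod hv, code_mod hv] at h
  have hl := code_eq_length hv hv h
  have he : p + e ≤ m := by
    clear h
    rcases le_total m e with h1 | h1 <;> rcases le_total (m - p) e with h2 | h2 <;>
      simp only [h1, h2, min_eq_left, min_eq_right] at hl <;> omega
  rw [min_eq_right (by omega), min_eq_right (by omega)] at h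
  exact ⟨he, fun j hj => (code_injective hv hv h j hj).symm⟩

theorem codeMatchLen_spec {X p : ℕ} (m : ℕ) :
    codeMatchLen X p m ≤ m ∧ (codeMatchLen X p m = 0 ∨ codeMatch X p (codeMatchLen X p m) = true) := by
  induction m with
  | zero => simp [codeMatchLen]
  | succ m ih =>
    rw [codeMatchLen]
    cases h : codeMatch X p (m + 1) with
    | true => exact ⟨le_rfl, Or.inr h⟩
    | false => exact ⟨by simpa using ih.1.trans (Nat.le_succ m), by simpa using ih.2⟩

/-- The periodic continuation in both directions of the last `p` letters before position `k`. -/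
def tail (v : ℕ → ℕ) (k p j : ℕ) : ℕ := v (k - p + j % p)

theorem tail_add (v : ℕ → ℕ) (k p j : ℕ) : tail v k p (j + p) = tail v k p j := by
  simp [tail]

theorem codeSlice_eq (hv : ∀ n, v n < 3) {n m p o l : ℕ} (hp : p ≤ m) (hol : o + l ≤ 4 * p) :
    codeSlice (code v n m) p o l = code (tail v (n + m) p) (4 * p - o - l) l := by
  set u := tail v (n + m) p with hu
  have hu3 : ∀ j, u j < 3 := fun j => hv _
  have h1 : ∀ k, code u (k * p) p = code v n m % 4 ^ p := by
    intro k
    rw [code_mod hv, min_eq_right hp]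
    refine code_congr fun j hj => ?_
    rw [hu, tail, Nat.add_comm (k * p), Nat.add_mul_mod_self_right, Nat.mod_eq_of_lt hj]
    congr 1
    omega
  have h2 : (code v n m % 4 ^ p) * (1 + 4 ^ p + 4 ^ (2 * p) + 4 ^ (3 * p)) = code u 0 (4 * p) := by
    have e0 := h1 0
    have e1 := h1 1
    have e2 := h1 2
    have e3 := h1 3
    rw [show 4 * p = p + p + p + p by ring, code_add, code_add, code_add, show 0 + (p + p + p) = 3 * p by ring,
      show 0 + (p + p) = 2 * p by ring, show 0 + p = 1 * p by ring, ← Nat.zero_mul p, e0, e1, e2, e3]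
    ring
  change (code v n m % 4 ^ p) * (1 + 4 ^ p + 4 ^ (2 * p) + 4 ^ (3 * p)) / 4 ^ o % 4 ^ l = _
  rw [h2, code_div hu3, code_mod hu3, min_eq_right (by omega), Nat.zero_add]

theorem seg_tail {n m p e : ℕ} (hp : 1 ≤ p) (he : e ≤ p) (hm : p + e ≤ m)
    (h : ∀ j < e, v (n + (m - p - e) + j) = v (n + (m - e) + j)) :
    Seg v (tail v (n + m) p) (4 * p - (p + e)) (p + e) := by
  refine ⟨n + m - (p + e), fun j hj => ?_⟩
  rw [tail]
  rcases lt_or_ge j e with hje | hje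
  · rw [show 4 * p - (p + e) + j = (p - e + j) + p * 2 by omega, Nat.add_mul_mod_self_left,
      Nat.mod_eq_of_lt (by omega)]
    convert h j hje using 2 <;> omega
  · rw [show 4 * p - (p + e) + j = (j - e) + p * 3 by omega, Nat.add_mul_mod_self_left,
      Nat.mod_eq_of_lt (by omega)]
    congr 1
    omega

theorem addSlices_sound (hv : ∀ n, v n < 3) {n m p : ℕ} (hp : p ≤ m)
    {sl : List (ℕ × ℕ)} (hsl : ∀ o l, (o, l) ∈ sl → o + l ≤ 4 * p ∧
      (Seg v (tail v (n + m) p) (4 * p - o - l) l → G))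
    {F : List (ℕ × ℕ)} (hF : ∀ f ∈ F, Forbidden G v f) {k : List (ℕ × ℕ) → Bool}
    (hk : ∀ F', (∀ f ∈ F', Forbidden G v f) → k F' = true → G)
    (h : addSlices (code v n m) p sl F k = true) : G := by
  induction sl generalizing F with
  | nil => exact hk F hF h
  | cons a sl ih =>
    obtain ⟨hol, hG⟩ := hsl a.1 a.2 List.mem_cons_self
    have hf : Forbidden G v (codeSlice (code v n m) p a.1 a.2, 4 ^ a.2) :=
      ⟨tail v (n + m) p, _, _, fun j => hv _, by rw [codeSlice_eq hv hp hol], hG⟩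
    rw [addSlices_cons] at h
    split at h
    · rename_i h1
      obtain ⟨j, -, hj⟩ := exists_of_anyTrue h1
      rw [code_div hv] at hj
      exact hf.of_codeSuffix hv hj
    · refine ih (fun o l hl => hsl o l (List.mem_cons_of_mem _ hl)) (fun f hf' => ?_) h
      rcases List.mem_cons.1 hf' with rfl | hf'
      · exact hf
      · exact hF f hf'

theorem addRuns_sound (hv : ∀ n, v n < 3) (hcomps : SoundComps G v comps) {n m : ℕ} (hm : 1 ≤ m)
    {ps : List ℕ} (hps : ∀ p ∈ ps, 1 ≤ p)
    {F : List (ℕ × ℕ)} (hF : ∀ f ∈ F, Forbidden G v f) {k : List (ℕ × ℕ) → Bool}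
    (hk : ∀ F', (∀ f ∈ F', Forbidden G v f) → k F' = true → G)
    (h : addRuns comps (code v n m) ps F k = true) : G := by
  induction ps generalizing F with
  | nil => exact hk F hF h
  | cons p ps ih =>
    have hp := hps p List.mem_cons_self
    have ih := fun F' hF' => ih (F := F') (fun q hq => hps q (List.mem_cons_of_mem _ hq)) hF'
    rw [addRuns_cons] at h
    split at h
    · rename_i h1
      have h1 := (codeMatch_spec hv hp hm (by omega) h1).1
      obtain ⟨h2, h3⟩ := codeMatchLen_spec (X := code v n m) (p := p) p
      have h4 : p + codeMatchLen (code v n m) p p ≤ m ∧ ∀ j < codeMatchLen (code v n m) p p,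
          v (n + (m - p - codeMatchLen (code v n m) p p) + j) =
            v (n + (m - codeMatchLen (code v n m) p p) + j) := by
        rcases Nat.eq_zero_or_pos (codeMatchLen (code v n m) p p) with h0 | h0
        · rw [h0]
          exact ⟨by omega, by simp⟩
        · exact codeMatch_spec hv hp hm h0 (h3.resolve_left h0.ne')
      refine addSlices_sound hv (by omega) (fun o l hol => ?_) hF ih h
      obtain ⟨h5, h6⟩ := hcomps p _ hp (by omega) o l hol
      exact ⟨h5, h6 _ (tail_add v _ p) (seg_tail hp h2 h4.1 h4.2)⟩
    · exact ih F hF h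

theorem searchStep_sound (hv : ∀ n, v n < 3) (hcomps : SoundComps G v comps)
    (hsq : ∀ p (u : ℕ → ℕ) s, 1 ≤ p → (∀ j, u (j + p) = u j) → Seg v u s (2 * p) → G)
    {n m : ℕ} (hm : 1 ≤ m) {ps : List ℕ} (hps : ∀ p ∈ ps, 1 ≤ p)
    {F : List (ℕ × ℕ)} (hF : ∀ f ∈ F, Forbidden G v f) {k : List (ℕ × ℕ) → Bool}
    (hk : ∀ F', (∀ f ∈ F', Forbidden G v f) → k F' = true → G)
    (h : searchStep comps ps (code v n m) F k = true) : G := by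
  rw [searchStep, branch_eq, branch_eq] at h
  split at h
  · rename_i h1
    obtain ⟨p, hp, h1⟩ := exists_of_anyTrue h1
    have hp := hps p hp
    obtain ⟨h2, h3⟩ := codeMatch_spec hv hp hm hp h1
    have := seg_tail hp le_rfl h2 h3
    rw [← two_mul] at this
    exact hsq p _ _ hp (tail_add v _ p) this
  · split at h
    · rename_i h1
      obtain ⟨f, hf, h1⟩ := exists_of_anyTrue h1
      exact (hF f hf).of_codeSuffix hv h1
    · exact addRuns_sound hv hcomps hm hps hF hk h

theorem search_sound (hv : ∀ n, v n < 3) (hcomps : SoundComps G v comps)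
    (hsq : ∀ p (u : ℕ → ℕ) s, 1 ≤ p → (∀ j, u (j + p) = u j) → Seg v u s (2 * p) → G)
    {ps : List ℕ} (hps : ∀ p ∈ ps, 1 ≤ p) {n m N : ℕ}
    {F : List (ℕ × ℕ)} (hF : ∀ f ∈ F, Forbidden G v f)
    (h : search comps ps N (code v n m) F = true) : G := by
  induction N generalizing m F with
  | zero => exact absurd h Bool.false_ne_true
  | succ N ih =>
    have hc := (search_succ comps ps N _ F).1 h (v (n + m) + 1) (by
      have := hv (n + m)
      simp
      omega)
    exact searchStep_sound hv hcomps hsq (m := m + 1) (by omega) hps hF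
      (fun F' hF' hF'' => ih (m := m + 1) hF' hF'') hc

theorem searchFrom_sound (hv : ∀ n, v n < 3) (hcomps : SoundComps G v comps)
    (hsq : ∀ p (u : ℕ → ℕ) s, 1 ≤ p → (∀ j, u (j + p) = u j) → Seg v u s (2 * p) → G)
    {ps : List ℕ} (hps : ∀ p ∈ ps, 1 ≤ p) {n m N : ℕ} {y : List ℕ}
    {F : List (ℕ × ℕ)} (hF : ∀ f ∈ F, Forbidden G v f)
    (hy : ∀ j < y.length, v (n + m + j) = y.getD j 0)
    (h : searchFrom comps ps N y (code v n m) F = true) : G := by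
  induction y generalizing m F with
  | nil => exact search_sound hv hcomps hsq hps hF h
  | cons c y ih =>
    simp only [searchFrom, force_eq] at h
    have hc : v (n + m) = c := by simpa using hy 0 (by simp)
    have e : Nat.add (Nat.mul 4 (code v n m)) (Nat.succ c) = code v n (m + 1) := by
      rw [code, hc]; rfl
    rw [e] at h
    refine searchStep_sound hv hcomps hsq (by omega) hps hF (fun F' hF' h' => ih hF' ?_ h') h
    intro j hj
    have := hy (j + 1) (by simpa using hj)
    simpa [Nat.add_assoc, Nat.add_comm 1 j] using this

end Soundness

/-! ### Every ternary word contains the critical configurations -/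

section Configurations

variable {α β : Type} {w : ℕ → α}

theorem Seg.comp {v : ℕ → α} {u : ℕ → α} {s d : ℕ} (h : Seg v u s d) (f : α → β) :
    Seg (fun n => f (v n)) (fun n => f (u n)) s d := by
  obtain ⟨n, hn⟩ := h
  exact ⟨n, fun j hj => congrArg f (hn j hj)⟩

theorem HasRun.comp (h : HasRun w) (f : α → β) : HasRun fun n => f (w n) := by
  obtain ⟨P, u, s, a, hP, hu, ha, h⟩ := h
  exact ⟨P, fun n => f (u n), s, a, hP, fun j => congrArg f (hu j), ha.comp f, h⟩

theorem HasPair.comp (h : HasPair w) (f : α → β) : HasPair fun n => f (w n) := by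
  obtain ⟨P, u, s, a, b, hP, hu, ha, hb, h⟩ := h
  exact ⟨P, fun n => f (u n), s, a, b, hP, fun j => congrArg f (hu j), ha.comp f, hb.comp f, h⟩

theorem HasSandwich.comp (h : HasSandwich w) (f : α → β) : HasSandwich fun n => f (w n) := by
  obtain ⟨P, u, s, a, b, hP, hu, ha, hb, h⟩ := h
  exact ⟨P, fun n => f (u n), s, a, b, hP, fun j => congrArg f (hu j), ha.comp f, hb.comp f, h⟩

variable {p : ℕ} {u : ℕ → α}

theorem hasRun_of_square {s : ℕ} (hp : 1 ≤ p) (hu : ∀ j, u (j + p) = u j)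
    (h : Seg w u s (2 * p)) : HasRun w :=
  ⟨p, u, s, 2 * p, hp, hu, h, by omega⟩

theorem hasPair_of_square {s : ℕ} (hp : 1 ≤ p) (hu : ∀ j, u (j + p) = u j)
    (h : Seg w u s (2 * p)) : HasPair w :=
  ⟨p, u, s, 2 * p, 2 * p, hp, hu, h, h.shift hu 2, by omega⟩

theorem hasSandwich_of_square {s : ℕ} (hp : 1 ≤ p) (hu : ∀ j, u (j + p) = u j)
    (h : Seg w u s (2 * p)) : HasSandwich w :=
  ⟨p, u, s, 2 * p, p, hp, hu, h, (h.shift hu 2).sub (k := 0) (by omega), by omega, by omega⟩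

end Configurations

/-- A run of length `a ≥ 7p/4` needs no companion, that is, its companion is the empty word. -/
def compsRun (p a : ℕ) : List (ℕ × ℕ) := bif Nat.ble (7 * p) (4 * a) then [(0, 0)] else []

/-- The companions of a run of length `a` and period `p`: the words that continue it to the right or
to the left as far as length `⌈13p/4⌉`. -/
def compsPair (p a : ℕ) : List (ℕ × ℕ) :=
  [(4 * p - ((13 * p + 3) / 4 - a), (13 * p + 3) / 4 - a), (a, (13 * p + 3) / 4 - a)]

/-- The companion of a run of length `a ≥ 5p/3` and period `p`: the word that continues it as far as
length `3p`. -/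
def compsSandwich (p a : ℕ) : List (ℕ × ℕ) :=
  bif Nat.ble (5 * p) (3 * a) then [(p + a, 3 * p - a)] else []

theorem compsRun_sound (v : ℕ → ℕ) : SoundComps (HasRun v) v compsRun := by
  intro p a hp ha o l h
  rw [compsRun] at h
  cases h7 : Nat.ble (7 * p) (4 * a) with
  | false => simp [h7] at h
  | true =>
    simp only [h7, cond_true, List.mem_singleton, Prod.mk.injEq] at h
    have := Nat.le_of_ble_eq_true h7
    exact ⟨by omega, fun u hu hr _ => ⟨p, u, _, a, hp, hu, hr, this⟩⟩

theorem compsPair_sound (v : ℕ → ℕ) : SoundComps (HasPair v) v compsPair := by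
  intro p a hp ha o l h
  simp only [compsPair, List.mem_cons, Prod.mk.injEq, List.not_mem_nil, or_false] at h
  rcases h with ⟨rfl, rfl⟩ | ⟨h1, rfl⟩
  · refine ⟨by omega, fun u hu hr hs => ⟨p, u, _, a, (13 * p + 3) / 4 - a, hp, hu, hr, ?_, ?_⟩⟩
    · have := hs.shift hu 4
      convert this using 1
      omega
    · omega
  · subst h1
    refine ⟨by omega, fun u hu hr hs => ⟨p, u, _, _, o, hp, hu, hs, ?_, ?_⟩⟩
    · convert hr using 1
      omega
    · omega

theorem compsSandwich_sound (v : ℕ → ℕ) : SoundComps (HasSandwich v) v compsSandwich := by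
  intro p a hp ha o l h
  rw [compsSandwich] at h
  cases h7 : Nat.ble (5 * p) (3 * a) with
  | false => simp [h7] at h
  | true =>
    simp only [h7, cond_true, List.mem_singleton, Prod.mk.injEq] at h
    have := Nat.le_of_ble_eq_true h7
    obtain ⟨rfl, rfl⟩ := h
    refine ⟨by omega, fun u hu hr hs => ⟨p, u, _, a, 3 * p - a, hp, hu, hr, ?_, ?_, this⟩⟩
    · have := hs.shift hu 4
      convert this using 1
      omega
    · omega

/-- The pair by which the search represents a forbidden word. -/
def codeList (y : List ℕ) : ℕ × ℕ := (code (fun j => y.getD j 0) 0 y.length, 4 ^ y.length)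

/-- The six words that arise from `y` by permuting the letters `0`, `1`, `2`. -/
def relabellings (y : List ℕ) : List (List ℕ) :=
  [[0, 1, 2], [0, 2, 1], [1, 0, 2], [1, 2, 0], [2, 0, 1], [2, 1, 0]].map fun s =>
    y.map fun c => s.getD c 0

/-- What the search needs to know about the property `G` it looks for: it is invariant under renaming
letters, words that contain squares have it, and `comps` leads to it. -/
structure Searchable (G : (ℕ → ℕ) → Prop) (comps : ℕ → ℕ → List (ℕ × ℕ)) : Prop where
  comp : ∀ (v f : ℕ → ℕ), G v → G fun n => f (v n)
  square : ∀ (v : ℕ → ℕ) p (u : ℕ → ℕ) s, 1 ≤ p → (∀ j, u (j + p) = u j) → Seg v u s (2 * p) → G v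
  sound : ∀ v, SoundComps (G v) v comps

section Search

variable {G : (ℕ → ℕ) → Prop} {comps : ℕ → ℕ → List (ℕ × ℕ)}

/-- All the words over `{0, 1, 2}` that have a given factor have the property `G`. -/
def AllForbidden (G : (ℕ → ℕ) → Prop) (F : List (ℕ × ℕ)) : Prop :=
  ∀ v : ℕ → ℕ, (∀ n, v n < 3) → ∀ f ∈ F, Forbidden (G v) v f

/-- If the search shows that a word with the factor `y` has the property `G`, then the same is true
for the words that arise from `y` by permuting the letters. -/
theorem Searchable.extend (hG : Searchable G comps) {ps : List ℕ} (hps : ∀ p ∈ ps, 1 ≤ p) {N : ℕ}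
    {F : List (ℕ × ℕ)} (hF : AllForbidden G F) {y : List ℕ} (hy : ∀ c ∈ y, c < 3)
    (h : searchFrom comps ps N y 0 F = true) :
    AllForbidden G ((relabellings y).map codeList ++ F) := by
  intro v hv f hf
  rcases List.mem_append.1 hf with hf | hf
  swap
  · exact hF v hv f hf
  obtain ⟨y', hy', rfl⟩ := List.mem_map.1 hf
  obtain ⟨s, hs, rfl⟩ := List.mem_map.1 hy'
  have h3 : ∀ c < 3, s.getD c 0 < 3 := by
    clear * - hs
    revert s; decide
  -- The inverse relabelling.
  obtain ⟨t, ht3, ht⟩ : ∃ t ∈ [[0, 1, 2], [0, 2, 1], [1, 0, 2], [1, 2, 0], [2, 0, 1], [2, 1, 0]],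
      (∀ c < 3, t.getD (s.getD c 0) 0 = c) ∧ ∀ c < 3, s.getD (t.getD c 0) 0 = c := by
    clear * - hs
    revert s; decide
  have ht3 : ∀ c < 3, t.getD c 0 < 3 := by
    clear * - ht3
    revert t; decide
  have hget : ∀ j < y.length,
      (y.map fun c => s.getD c 0).getD j 0 = s.getD (y.getD j 0) 0 := fun j hj => by simp [hj]
  have hy3 : ∀ j, y.getD j 0 < 3 := fun j => by
    rcases lt_or_ge j y.length with hj | hj
    · simpa [hj] using hy _ (List.getElem_mem hj)
    · simp [hj]
  refine ⟨fun j => s.getD (y.getD j 0) 0, 0, y.length, fun j => h3 _ (hy3 j), ?_, ?_⟩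
  · rw [codeList, List.length_map, code_congr (n' := 0)]
    intro j hj
    simpa using hget j (by simpa using hj)
  · rintro ⟨n, hn⟩
    have hv' : ∀ n, t.getD (v n) 0 < 3 := fun n => ht3 _ (hv n)
    have key := searchFrom_sound (n := n) (m := 0) hv' (hG.sound _) (hG.square _) hps (hF _ hv')
      (y := y) ?_ h
    · have := hG.comp _ (fun c => s.getD c 0) key
      simpa only [ht.2 _ (hv _)] using this
    · intro j hj
      have := hn j hj
      simp only [Nat.zero_add] at this
      rw [Nat.add_zero, this, ht.1 _ (hy3 j)]

theorem Searchable.forall (hG : Searchable G comps) {ps : List ℕ} (hps : ∀ p ∈ ps, 1 ≤ p) {N : ℕ}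
    {F : List (ℕ × ℕ)} (hF : AllForbidden G F) (h : search comps ps N 0 F = true)
    {v : ℕ → ℕ} (hv : ∀ n, v n < 3) : G v :=
  search_sound (n := 0) (m := 0) hv (hG.sound v) (hG.square v) hps (hF v hv) h

theorem allForbidden_nil : AllForbidden G [] := fun _ _ _ hf => absurd hf List.not_mem_nil

end Search

theorem searchable_hasRun : Searchable HasRun compsRun :=
  ⟨fun _ f h => h.comp f, fun _ _ _ _ hp hu h => hasRun_of_square hp hu h, compsRun_sound⟩

theorem searchable_hasPair : Searchable HasPair compsPair :=
  ⟨fun _ f h => h.comp f, fun _ _ _ _ hp hu h => hasPair_of_square hp hu h, compsPair_sound⟩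

theorem searchable_hasSandwich : Searchable HasSandwich compsSandwich :=
  ⟨fun _ f h => h.comp f, fun _ _ _ _ hp hu h => hasSandwich_of_square hp hu h,
    compsSandwich_sound⟩

theorem val_ofNat_fin (c : Fin 3) : Fin.ofNat 3 c.val = c := Fin.ofNat_val_eq_self c

/-- The periods of the runs that the searches for pairs and sandwiches look at. The searches end
already with these few periods. -/
def searchPeriods : List ℕ := [1, 2, 3, 4, 6, 8, 11, 12, 15, 18, 23, 35]

/-- The periods of the runs that the search for a run looks at. -/
def searchPeriodsRun : List ℕ := [1, 2, 3, 4, 6, 8, 11, 12, 13, 14, 15, 18, 21, 23, 35]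

/-- The codes of the words `01201`, …, of exponent `5/3`. -/
def cubicSeeds : List (ℕ × ℕ) :=
  [(438, 1024), (487, 1024), (633, 1024), (731, 1024), (877, 1024), (926, 1024)]

/-- The codes of the words `1020102`, …, of exponent `7/4`. -/
def quarticSeeds : List (ℕ × ℕ) :=
  [(10087, 16384), (13942, 16384), (7067, 16384), (14777, 16384), 
    (7902, 16384), (11757, 16384)]

theorem map_codeList_cubic : (relabellings [0, 1, 2, 0, 1]).map codeList = cubicSeeds := by
  decide

theorem map_codeList_quartic :
    (relabellings [1, 0, 2, 0, 1, 0, 2]).map codeList = quarticSeeds := by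
  decide

set_option maxRecDepth 100000

/-! The numbers `60` and `120` in the following searches are larger than the depths of the search
trees. -/

theorem search_run_cubic :
    searchFrom compsRun searchPeriodsRun 60 [0, 1, 2, 0, 1] 0 [] = true := by
  decide +kernel

theorem search_run :
    search compsRun searchPeriodsRun 60 0 (cubicSeeds ++ []) = true := by
  decide +kernel

theorem search_sandwich_cubic :
    searchFrom compsSandwich searchPeriods 60 [0, 1, 2, 0, 1] 0 [] = true := by
  decide +kernel

theorem search_sandwich_quartic :
    searchFrom compsSandwich searchPeriods 60 [1, 0, 2, 0, 1, 0, 2] 0 (cubicSeeds ++ []) = true := by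
  decide +kernel

theorem search_sandwich :
    search compsSandwich searchPeriods 60 0 (quarticSeeds ++ (cubicSeeds ++ [])) = true := by
  decide +kernel

theorem search_pair_quartic :
    searchFrom compsPair searchPeriods 120 [1, 0, 2, 0, 1, 0, 2] 0 [] = true := by
  decide +kernel

theorem search_pair_cubic :
    searchFrom compsPair searchPeriods 60 [0, 1, 2, 0, 1] 0 (quarticSeeds ++ []) = true := by
  decide +kernel

theorem search_pair :
    search compsPair searchPeriods 60 0 (cubicSeeds ++ (quarticSeeds ++ [])) = true := by
  decide +kernel

theorem hasRun_ternary (w : ℕ → Fin 3) : HasRun w := by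
  have hps : ∀ p ∈ searchPeriodsRun, 1 ≤ p := by decide
  have h1 := searchable_hasRun.extend hps allForbidden_nil (by decide) search_run_cubic
  rw [map_codeList_cubic] at h1
  have h2 := searchable_hasRun.forall hps h1 search_run (v := fun n => (w n).val)
    fun n => (w n).isLt
  simpa only [val_ofNat_fin] using h2.comp (Fin.ofNat 3)

theorem hasSandwich_ternary (w : ℕ → Fin 3) : HasSandwich w := by
  have hps : ∀ p ∈ searchPeriods, 1 ≤ p := by decide
  have h1 := searchable_hasSandwich.extend hps allForbidden_nil (by decide) search_sandwich_cubic
  rw [map_codeList_cubic] at h1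
  have h2 := searchable_hasSandwich.extend hps h1 (by decide) search_sandwich_quartic
  rw [map_codeList_quartic] at h2
  have h3 := searchable_hasSandwich.forall hps h2 search_sandwich (v := fun n => (w n).val)
    fun n => (w n).isLt
  simpa only [val_ofNat_fin] using h3.comp (Fin.ofNat 3)

theorem hasPair_ternary (w : ℕ → Fin 3) : HasPair w := by
  have hps : ∀ p ∈ searchPeriods, 1 ≤ p := by decide
  have h1 := searchable_hasPair.extend hps allForbidden_nil (by decide) search_pair_quartic
  rw [map_codeList_quartic] at h1
  have h2 := searchable_hasPair.extend hps h1 (by decide) search_pair_cubic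
  rw [map_codeList_cubic] at h2
  have h3 := searchable_hasPair.forall hps h2 search_pair (v := fun n => (w n).val)
    fun n => (w n).isLt
  simpa only [val_ofNat_fin] using h3.comp (Fin.ofNat 3)

/-! ### Sets of positions coded by numbers -/

/-- The number whose binary expansion consists of the blocks `f 0`, …, `f (n - 1)` of `q` bits. -/
def concat (f : ℕ → ℕ) (q : ℕ) : ℕ → ℕ
  | 0 => 0
  | n + 1 => Nat.lor (concat f q n) (Nat.shiftLeft (f n) (Nat.mul q n))

theorem testBit_concat {f : ℕ → ℕ} {q : ℕ} (hq : 0 < q) (hf : ∀ a, f a < 2 ^ q) (n i : ℕ) :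
    (concat f q n).testBit i = (decide (i / q < n) && (f (i / q)).testBit (i % q)) := by
  induction n with
  | zero => simp [concat]
  | succ n ih =>
    change (concat f q n ||| f n <<< (q * n)).testBit i = _
    rw [Nat.testBit_or, ih, Nat.testBit_shiftLeft]
    rcases lt_trichotomy (i / q) n with h | h | h
    · have h1 : ¬ q * n ≤ i := fun h2 => by
        have : n ≤ i / q := (Nat.le_div_iff_mul_le hq).2 (by rwa [Nat.mul_comm] at h2)
        omega
      simp [h, h1, h.trans (Nat.lt_succ_self n)]
    · have h1 : q * n ≤ i := by rw [← h]; exact Nat.mul_div_le i q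
      have h2 : i - q * n = i % q := by
        rw [← h, ← Nat.mod_def]
      simp [h, h1, h2]
    · have h1 : q ≤ i - q * n := by
        have h2 : q * (n + 1) ≤ i := (Nat.mul_le_mul_left q h).trans (Nat.mul_div_le i q)
        rw [Nat.mul_succ] at h2
        omega
      have h2 : (f n).testBit (i - q * n) = false :=
        Nat.testBit_lt_two_pow ((hf n).trans_le (Nat.pow_le_pow_right (by norm_num) h1))
      have h3 : ¬ i / q < n := by omega
      have h4 : ¬ i / q < n + 1 := by omega
      simp [h2, h3, h4]

/-- `forceMap f l k = k (l.map f)`, with the members of `l.map f` evaluated to numerals. -/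
def forceMap {α : Type} (f : α → ℕ) : List α → (List ℕ → Bool) → Bool
  | [], k => k []
  | a :: l, k => force (f a) fun x => forceMap f l fun y => k (x :: y)

@[simp] theorem forceMap_eq {α : Type} (f : α → ℕ) (l : List α) (k : List ℕ → Bool) :
    forceMap f l k = k (l.map f) := by
  induction l generalizing k with
  | nil => rfl
  | cons a l ih => simp [forceMap, ih]

/-- Does `f` hold for the `2 ^ d` numbers from `a` on? -/
def allFrom (f : ℕ → Bool) (d : ℕ) : ℕ → Bool :=
  Nat.rec (fun a => f a)
    (fun d ih a => branch (ih a) (force (Nat.add a (Nat.pow 2 d)) ih) false) d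

theorem of_allFrom {f : ℕ → Bool} {d a : ℕ} (h : allFrom f d a = true) {i : ℕ} (hi : a ≤ i)
    (hi' : i < a + 2 ^ d) : f i = true := by
  induction d generalizing a with
  | zero =>
    rw [show i = a by simp at hi'; omega]
    exact h
  | succ d ih =>
    have h' : allFrom f d a = true ∧ allFrom f d (a + 2 ^ d) = true := by
      have h1 : branch (allFrom f d a) (force (a + 2 ^ d) (allFrom f d)) false = true := h
      rw [force_eq] at h1
      rw [branch_eq] at h1
      simpa using h1
    rcases lt_or_ge i (a + 2 ^ d) with h2 | h2
    · exact ih h'.1 hi h2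
    · exact ih h'.2 h2 (by rw [pow_succ] at hi'; omega)

/-- The numbers `Xs` represent the first `N` letters of the word `W`: the bit of each of them at a
position is a function of the letter there. -/
def Planes (W : ℕ → ℕ) (N : ℕ) (Xs : List ℕ) : Prop :=
  ∀ X ∈ Xs, ∃ f : ℕ → Bool, ∀ i < N, X.testBit i = f (W i)

/-- The positions where one of the `Xs` differs from its shift by `p`. -/
def mismatch (Xs : List ℕ) (p : ℕ) : ℕ :=
  List.rec 0 (fun X _ ih => Nat.lor (Nat.xor X (Nat.shiftRight X p)) ih) Xs

theorem Planes.mismatch {W : ℕ → ℕ} {N : ℕ} {Xs : List ℕ} (h : Planes W N Xs) {p i : ℕ}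
    (hi : i + p < N) (hm : (mismatch Xs p).testBit i = true) : W i ≠ W (i + p) := by
  induction Xs with
  | nil => simp [_root_.mismatch] at hm
  | cons X Xs ih =>
    change ((X ^^^ X >>> p) ||| _root_.mismatch Xs p).testBit i = true at hm
    rw [Nat.testBit_or, Bool.or_eq_true] at hm
    rcases hm with hm | hm
    · obtain ⟨f, hf⟩ := h X List.mem_cons_self
      intro he
      rw [Nat.testBit_xor, Nat.testBit_shiftRight, Nat.add_comm p i, hf i (by omega),
        hf (i + p) hi, he] at hm
      simp at hm
    · exact ih (fun Y hY => h Y (List.mem_cons_of_mem _ hY)) hm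

/-- The number `D`, moved to make room for a label. Numbers which agree in their last bits have equal
hash values, and so do the terms in which they occur; the label prevents this. -/
def tag (p D : ℕ) : ℕ := Nat.lor (Nat.shiftLeft D 64) (Nat.mod p (Nat.pow 2 64))

/-- The number without its label. -/
def untag (X : ℕ) : ℕ := Nat.shiftRight X 64

theorem untag_tag (p D : ℕ) : untag (tag p D) = D := by
  change (D <<< 64 ||| p % 2 ^ 64) >>> 64 = D
  refine Nat.eq_of_testBit_eq fun i => ?_
  rw [Nat.testBit_shiftRight, Nat.testBit_or, Nat.testBit_shiftLeft, Nat.testBit_mod_two_pow]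
  simp

/-- Given that `X` is, with the label `p`, a set of positions smeared to windows of length `a`, smear
it further, to windows of length at most `l`, until it covers together with `O` the numbers less than
`M`. -/
def covers (M O l p : ℕ) : ℕ → ℕ → ℕ → Bool
  | 0, _, _ => false
  | n + 1, a, X =>
    branch (Nat.beq (Nat.mod (Nat.lor (untag X) O) (Nat.pow 2 M)) (Nat.sub (Nat.pow 2 M) 1)) true
      (branch (Nat.ble l a) false
        (force (smearStep a l) fun s =>
          force (tag p (Nat.lor (untag X) (Nat.shiftRight (untag X) s))) fun Y =>
            force (Nat.add a s) fun a' => covers M O l p n a' Y))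
where
  /-- The smaller one of `a` and `l - a`. -/
  smearStep (a l : ℕ) : ℕ := bif Nat.ble (Nat.add a a) l then a else Nat.sub l a

/-- The invariant of `covers`: each position in the smeared set is followed, within the length of the
window, by a position with the property `P`. -/
theorem of_covers {M O l p n a X : ℕ} {P : ℕ → Prop} (ha : a ≤ l)
    (hD : ∀ i, (untag X).testBit i = true → ∃ j < a, P (i + j))
    (h : covers M O l p n a X = true)
    {i : ℕ} (hi : i < M) : O.testBit i = true ∨ ∃ j < l, P (i + j) := by
  induction n generalizing a X with
  | zero => exact absurd h Bool.false_ne_true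
  | succ n ih =>
    simp only [covers, branch_eq, force_eq] at h
    split at h
    · rename_i h1
      have h2 : (untag X ||| O) % 2 ^ M = 2 ^ M - 1 := Nat.eq_of_beq_eq_true h1
      have h3 : ((untag X ||| O) % 2 ^ M).testBit i = true := by
        rw [h2, Nat.testBit_two_pow_sub_one]
        simpa using hi
      rw [Nat.testBit_mod_two_pow, Nat.testBit_or] at h3
      simp only [hi, decide_true, Bool.true_and, Bool.or_eq_true] at h3
      rcases h3 with h3 | h3
      · obtain ⟨j, hj, hP⟩ := hD i h3
        exact Or.inr ⟨j, by omega, hP⟩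
      · exact Or.inl h3
    · split at h
      · exact absurd h Bool.false_ne_true
      · rename_i h1
        have h2 : a < l := by
          by_contra hl
          exact h1 (Nat.ble_eq_true_of_le (by omega))
        have h3 : covers.smearStep a l ≤ a ∧ a + covers.smearStep a l ≤ l := by
          rw [covers.smearStep]
          cases h4 : Nat.ble (Nat.add a a) l with
          | true =>
            have := Nat.le_of_ble_eq_true h4
            exact ⟨le_rfl, this⟩
          | false =>
            have : ¬ a + a ≤ l := fun hl => by
              rw [Nat.ble_eq_true_of_le (show Nat.add a a ≤ l from hl)] at h4
              exact Bool.false_ne_true h4.symm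
            simp only [cond_false, Nat.sub_eq]
            omega
        refine ih h3.2 (fun i hi => ?_) h
        rw [untag_tag] at hi
        change (untag X ||| untag X >>> covers.smearStep a l).testBit i = true at hi
        rw [Nat.testBit_or, Bool.or_eq_true, Nat.testBit_shiftRight] at hi
        rcases hi with hi | hi
        · obtain ⟨j, hj, hP⟩ := hD i hi
          exact ⟨j, by omega, hP⟩
        · obtain ⟨j, hj, hP⟩ := hD _ hi
          exact ⟨covers.smearStep a l + j, by omega,
            by rwa [show i + (covers.smearStep a l + j) = covers.smearStep a l + i + j by omega]⟩

theorem of_covers_mismatch {W : ℕ → ℕ} {N M O l n p : ℕ} {Xs : List ℕ} (hX : Planes W N Xs)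
    (hN : M + l + p ≤ N + 1) (hl : 1 ≤ l) (h : covers M O l p n 1 (tag p (mismatch Xs p)) = true) {i : ℕ}
    (hi : i < M) : O.testBit i = true ∨ ∃ j < l, W (i + j) ≠ W (i + j + p) := by
  have := of_covers (P := fun k => k + p < N → W k ≠ W (k + p)) hl
    (fun i hi => ⟨0, one_pos, fun hN => hX.mismatch hN (by rwa [untag_tag] at hi)⟩) h hi
  refine this.imp_right fun ⟨j, hj, h⟩ => ⟨j, hj, h (by omega)⟩

/-- The test that the windows of length `m` at two positions less than `B` agree only if `Q` divides
the distance of these positions; here `B ≤ 2 ^ d`. -/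
def syncCheck (Xs : List ℕ) (Q B m d : ℕ) : Bool :=
  allFrom (fun p => branch (Nat.beq (Nat.mod p Q) 0) true
    (branch (Nat.ble B p) true
      (force (tag p (mismatch Xs p)) fun X => covers (Nat.sub B p) 0 m p 10 1 X))) d 0

theorem of_syncCheck {W : ℕ → ℕ} {N Q B m d : ℕ} {Xs : List ℕ} (hX : Planes W N Xs)
    (hm : 1 ≤ m) (hN : B + m ≤ N + 1) (hd : B ≤ 2 ^ d) (h : syncCheck Xs Q B m d = true)
    {i p : ℕ} (hi : i + p < B) (hW : ∀ j < m, W (i + j) = W (i + p + j)) : Q ∣ p := by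
  have h1 := of_allFrom h (i := p) (Nat.zero_le p) (by omega)
  simp only [branch_eq, force_eq] at h1
  split at h1
  · rename_i h2
    exact Nat.dvd_of_mod_eq_zero (Nat.eq_of_beq_eq_true h2)
  · split at h1
    · rename_i h2
      have := Nat.le_of_ble_eq_true h2
      omega
    · have h2 : (Nat.sub B p) = B - p := rfl
      rcases of_covers_mismatch hX (by omega) hm h1 (i := i) (by omega) with h3 | ⟨j, hj, h3⟩
      · simp at h3
      · rw [hW j hj, Nat.add_right_comm] at h3
        exact absurd rfl h3

/-- The test that there are no two letters at distance `p` followed by runs of length `l p`, for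
positions less than `B` and `1 ≤ p ≤ 2 ^ d`. -/
def runCheck (Xs : List ℕ) (B : ℕ) (l : ℕ → ℕ) (d : ℕ) : Bool :=
  allFrom (fun p => force (tag p (mismatch Xs p)) fun X => force (l p) fun l' =>
    covers B 0 l' p 10 1 X) d 1

theorem of_runCheck {W : ℕ → ℕ} {N B d : ℕ} {l : ℕ → ℕ} {Xs : List ℕ} (hX : Planes W N Xs)
    (h : runCheck Xs B l d = true) {i p : ℕ} (hp : 1 ≤ p) (hpd : p ≤ 2 ^ d) (hi : i < B)
    (hl : 1 ≤ l p) (hN : B + l p + p ≤ N + 1) : ∃ j < l p, W (i + j) ≠ W (i + j + p) := by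
  have h1 := of_allFrom h hp (by omega)
  simp only [force_eq] at h1
  simpa using of_covers_mismatch hX hN hl h1 hi

/-! ### Words coded by shorter words -/

/-- The digit of weight `10 ^ r` of a number; it serves to write down finite sequences. -/
def digit (D r : ℕ) : ℕ := Nat.mod (Nat.div D (Nat.pow 10 r)) 10

/-- The word `W` is obtained from the word `t` by replacing each letter `a` by the block
`F a 0, …, F a (Q - 1)`. -/
def Coded (W t : ℕ → ℕ) (Q : ℕ) (F : ℕ → ℕ → ℕ) : Prop := ∀ n, W n = F (t (n / Q)) (n % Q)

/-- All the factors of `t` of length `f` occur at positions less than `K`. -/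
def FactorsBelow (t : ℕ → ℕ) (f K : ℕ) : Prop := ∀ n, ∃ n' < K, ∀ j < f, t (n' + j) = t (n + j)

section Coded

variable {W t : ℕ → ℕ} {Q : ℕ} {F : ℕ → ℕ → ℕ}

theorem Coded.congr (hW : Coded W t Q F) (hQ : 0 < Q) {f n k : ℕ}
    (h : ∀ j < f + 1, t (k + j) = t (n / Q + j)) {j : ℕ} (hj : j ≤ f * Q) :
    W (Q * k + n % Q + j) = W (n + j) := by
  have h1 : Q * k + n % Q + j = Q * k + (n % Q + j) := by ring
  have h2 : n + j = Q * (n / Q) + (n % Q + j) := by have := Nat.div_add_mod n Q; omega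
  have h3 : (n % Q + j) / Q < f + 1 := by
    rw [Nat.div_lt_iff_lt_mul hQ, Nat.succ_mul]
    have := Nat.mod_lt n hQ
    omega
  rw [h1, h2, hW, hW, Nat.mul_add_div hQ, Nat.mul_add_div hQ, Nat.mul_add_mod, Nat.mul_add_mod,
    h _ h3]

/-- A window of length `f * Q + 1` meets at most `f + 1` blocks. -/
theorem Coded.exists_window (hW : Coded W t Q F) (hQ : 0 < Q) {f K : ℕ}
    (ht : FactorsBelow t (f + 1) K) (n : ℕ) :
    ∃ n' < K * Q, n' % Q = n % Q ∧ ∀ j ≤ f * Q, W (n' + j) = W (n + j) := by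
  obtain ⟨k, hk, h⟩ := ht (n / Q)
  refine ⟨Q * k + n % Q, ?_, by simp, fun j hj => hW.congr hQ h hj⟩
  have h1 : Q * (k + 1) ≤ Q * K := Nat.mul_le_mul_left Q hk
  have h2 := Nat.mod_lt n hQ
  rw [Nat.mul_succ] at h1
  rw [Nat.mul_comm K Q]
  omega

/-- If the windows of length `m` at two positions agree, then `Q` divides the distance of these
positions. -/
def Synchronized (W : ℕ → ℕ) (Q m : ℕ) : Prop :=
  ∀ n p, (∀ j < m, W (n + j) = W (n + p + j)) → Q ∣ p

theorem Coded.synchronized (hW : Coded W t Q F) (hQ : 0 < Q) {K N m d : ℕ}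
    (ht : FactorsBelow t 2 K) {Xs : List ℕ} (hX : Planes W N Xs) (hm : 1 ≤ m) (hmQ : m ≤ Q + 1)
    (hN : K * Q + m ≤ N + 1) (hd : K * Q ≤ 2 ^ d)
    (h : syncCheck Xs Q (K * Q) m d = true) : Synchronized W Q m := by
  intro n p hnp
  obtain ⟨a, ha, ha', hWa⟩ := hW.exists_window hQ ht n
  obtain ⟨b, hb, hb', hWb⟩ := hW.exists_window hQ ht (n + p)
  have hab : ∀ j < m, W (a + j) = W (b + j) := fun j hj => by
    rw [hWa j (by omega), hWb j (by omega), hnp j hj]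
  have key : a ≡ b [MOD Q] := by
    rcases le_total a b with hle | hle
    · obtain ⟨c, rfl⟩ := Nat.exists_eq_add_of_le hle
      have := of_syncCheck hX hm hN hd h (i := a) (p := c) hb hab
      simpa [Nat.ModEq] using (Nat.modEq_zero_iff_dvd.2 this).symm.add_left a
    · obtain ⟨c, rfl⟩ := Nat.exists_eq_add_of_le hle
      have := of_syncCheck hX hm hN hd h (i := b) (p := c) ha fun j hj => (hab j hj).symm
      simpa [Nat.ModEq] using ((Nat.modEq_zero_iff_dvd.2 this).symm.add_left b).symm
  have h1 : n + 0 ≡ n + p [MOD Q] := by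
    have : n ≡ n + p [MOD Q] := by
      unfold Nat.ModEq at *
      omega
    simpa using this
  exact (Nat.modEq_zero_iff_dvd.1 (Nat.ModEq.add_left_cancel' n h1).symm)

theorem Coded.exists_ne (hW : Coded W t Q F) (hQ : 0 < Q) {K N d : ℕ} {l : ℕ → ℕ}
    (ht : FactorsBelow t 3 K) {Xs : List ℕ} (hX : Planes W N Xs)
    (h : runCheck Xs (K * Q) l d = true) {p : ℕ} (hp : 1 ≤ p) (hpd : p ≤ 2 ^ d) (hl : 1 ≤ l p)
    (hlQ : l p + p ≤ 2 * Q + 1) (hN : K * Q + 2 * Q ≤ N) (n : ℕ) :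
    ∃ j < l p, W (n + j) ≠ W (n + j + p) := by
  obtain ⟨a, ha, -, hWa⟩ := hW.exists_window hQ ht n
  obtain ⟨j, hj, h1⟩ := of_runCheck hX h hp hpd ha hl (by omega)
  refine ⟨j, hj, ?_⟩
  rwa [hWa j (by omega), Nat.add_assoc, hWa (j + p) (by omega), ← Nat.add_assoc] at h1

end Coded

/-! ### Words defined by sums of digits -/

/-- The sum modulo `N` of the numbers `h d`, where `d` runs through the digits of `n` in base `B`. -/
def digitSum (B N : ℕ) (h : ℕ → ℕ) (n : ℕ) : ℕ := go n n
where
  /-- The same sum, restricted to the last `k` digits. -/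
  go : ℕ → ℕ → ℕ
    | 0, _ => 0
    | _ + 1, 0 => 0
    | k + 1, n + 1 => Nat.mod (Nat.add (h (Nat.mod (n + 1) B)) (go k (Nat.div (n + 1) B))) N

section DigitSum

variable {B N : ℕ} {h : ℕ → ℕ}

theorem digitSum_go (hB : 2 ≤ B) {k n : ℕ} (hk : n ≤ k) :
    digitSum.go B N h k n = digitSum B N h n := by
  rw [digitSum]
  induction n using Nat.strong_induction_on generalizing k with
  | _ n ih =>
    cases n with
    | zero => cases k <;> rfl
    | succ n =>
      obtain ⟨k, rfl⟩ : ∃ k', k = k' + 1 := ⟨k - 1, by omega⟩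
      have h1 : (n + 1) / B < n + 1 := Nat.div_lt_self (by omega) hB
      change (h ((n + 1) % B) + digitSum.go B N h k ((n + 1) / B)) % N =
        (h ((n + 1) % B) + digitSum.go B N h n ((n + 1) / B)) % N
      rw [ih _ h1 (by omega), ← ih _ h1 (k := n) (by omega)]

theorem digitSum_eq (hB : 2 ≤ B) (h0 : h 0 = 0) (n : ℕ) :
    digitSum B N h n = (h (n % B) + digitSum B N h (n / B)) % N := by
  cases n with
  | zero => simp [digitSum, digitSum.go, h0]
  | succ n =>
    have h1 : (n + 1) / B < n + 1 := Nat.div_lt_self (by omega) hB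
    rw [← digitSum_go hB (k := n) (n := (n + 1) / B) (by omega)]
    rfl

theorem coded_digitSum (hB : 2 ≤ B) (h0 : h 0 = 0) :
    Coded (digitSum B N h) (digitSum B N h) B fun a r => (h r + a) % N :=
  digitSum_eq hB h0

theorem digitSum_lt (hN : 0 < N) (hB : 2 ≤ B) (h0 : h 0 = 0) (n : ℕ) : digitSum B N h n < N := by
  rw [digitSum_eq hB h0]
  exact Nat.mod_lt _ hN

theorem digitSum_div_eq (hN : 0 < N) (hB : 2 ≤ B) (h0 : h 0 = 0) {n n' : ℕ}
    (hr : n % B = n' % B) (ht : digitSum B N h n = digitSum B N h n') :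
    digitSum B N h (n / B) = digitSum B N h (n' / B) := by
  rw [digitSum_eq hB h0 n, digitSum_eq hB h0 n', hr] at ht
  have : digitSum B N h (n / B) ≡ digitSum B N h (n' / B) [MOD N] :=
    Nat.ModEq.add_left_cancel' _ ht
  rwa [Nat.ModEq, Nat.mod_eq_of_lt (digitSum_lt hN hB h0 _),
    Nat.mod_eq_of_lt (digitSum_lt hN hB h0 _)] at this

end DigitSum

/-- The letters `t n, …, t (n + f - 1)` as digits in base `N`. -/
def factorCode (t : ℕ → ℕ) (N : ℕ) : ℕ → ℕ → ℕ
  | 0, _ => 0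
  | f + 1, n => Nat.add (t n) (Nat.mul N (factorCode t N f (n + 1)))

theorem factorCode_injective {t : ℕ → ℕ} {N : ℕ} (ht : ∀ n, t n < N) {f n n' : ℕ}
    (h : factorCode t N f n = factorCode t N f n') : ∀ j < f, t (n + j) = t (n' + j) := by
  induction f generalizing n n' with
  | zero => simp
  | succ f ih =>
    change t n + N * _ = t n' + N * _ at h
    have h1 : t n = t n' := by
      have := congrArg (· % N) h
      simpa [Nat.mod_eq_of_lt (ht _)] using this
    have h2 : factorCode t N f (n + 1) = factorCode t N f (n' + 1) := by
      rw [h1] at h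
      exact Nat.eq_of_mul_eq_mul_left (Nat.zero_lt_of_lt (ht 0)) (Nat.add_left_cancel h)
    intro j hj
    cases j with
    | zero => simpa using h1
    | succ j => simpa [Nat.add_assoc, Nat.add_comm 1 j] using ih h2 j (by omega)

/-- The set of the codes of the factors of length `f` at positions less than `M`. -/
def factorSet (t : ℕ → ℕ) (N f : ℕ) : ℕ → ℕ
  | 0 => 0
  | n + 1 => Nat.lor (factorSet t N f n) (Nat.pow 2 (factorCode t N f n))

theorem testBit_factorSet {t : ℕ → ℕ} {N f M c : ℕ} :
    (factorSet t N f M).testBit c = true ↔ ∃ n < M, factorCode t N f n = c := by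
  induction M with
  | zero => simp [factorSet]
  | succ M ih =>
    change (factorSet t N f M ||| 2 ^ factorCode t N f M).testBit c = true ↔ _
    rw [Nat.testBit_or, Bool.or_eq_true, ih, Nat.testBit_two_pow, decide_eq_true_eq]
    constructor
    · rintro (⟨n, hn, h⟩ | h)
      · exact ⟨n, by omega, h⟩
      · exact ⟨M, by omega, h⟩
    · rintro ⟨n, hn, h⟩
      rcases Nat.lt_succ_iff_lt_or_eq.1 hn with hn | rfl
      · exact Or.inl ⟨n, hn, h⟩
      · exact Or.inr h

/-- The factors of length at least `2` at position `n` are determined by those at position `n / B`. So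
it suffices that the first `K * B` positions have no more factors than the first `K` ones. -/
theorem Coded.factorsBelow {t : ℕ → ℕ} {B N f K : ℕ} {F : ℕ → ℕ → ℕ} (hB : 2 ≤ B)
    (ht : Coded t t B F) (htN : ∀ n, t n < N) (hK : 1 ≤ K)
    (h : factorSet t N (f + 1) (K * B) = factorSet t N (f + 1) K) : FactorsBelow t (f + 1) K := by
  intro n
  induction n using Nat.strong_induction_on with
  | _ n ih =>
    rcases lt_or_ge n K with hn | hn
    · exact ⟨n, hn, fun _ _ => rfl⟩
    · obtain ⟨k, hk, h1⟩ := ih (n / B) (Nat.div_lt_self (by omega) hB)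
      have h2 : B * k + n % B < K * B := by
        have h1 : B * (k + 1) ≤ B * K := Nat.mul_le_mul_left B hk
        have h2 := Nat.mod_lt n (show 0 < B by omega)
        rw [Nat.mul_succ] at h1
        rw [Nat.mul_comm K B]
        omega
      have h3 : (factorSet t N (f + 1) K).testBit (factorCode t N (f + 1) (B * k + n % B)) = true := by
        rw [← h]
        exact testBit_factorSet.2 ⟨_, h2, rfl⟩
      obtain ⟨n', hn', h4⟩ := testBit_factorSet.1 h3
      refine ⟨n', hn', fun j hj => ?_⟩
      rw [factorCode_injective htN h4 j hj]
      refine ht.congr (by omega) h1 ?_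
      nlinarith

/-- The induction that bounds the runs of a word which is coded by itself: a run that is too long for
its period is synchronized, and so it comes from a run that is shorter by the factor `B`. -/
theorem run_bound {t : ℕ → ℕ} {B m a c d : ℕ} (hB : 2 ≤ B)
    (hdiv : ∀ n n', n % B = n' % B → t n = t n' → t (n / B) = t (n' / B))
    (hsync : Synchronized t B m) (hm : 1 ≤ m)
    (hsmall : ∀ n p l, 1 ≤ p → l < m → (∀ j < l, t (n + j) = t (n + j + p)) → a * l + c ≤ d * p) :
    ∀ p n l, 1 ≤ p → (∀ j < l, t (n + j) = t (n + j + p)) → a * l + c ≤ d * p := by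
  intro p
  induction p using Nat.strong_induction_on with
  | _ p ih =>
    intro n l hp h
    rcases lt_or_ge l m with hl | hl
    · exact hsmall n p l hp hl h
    obtain ⟨q, rfl⟩ := hsync n p fun j hj => by rw [h j (by omega), Nat.add_right_comm]
    have hq : 1 ≤ q := Nat.pos_of_ne_zero fun hq => by simp [hq] at hp
    have hB0 : 0 < B := by omega
    have h1 := ih q (by nlinarith) (n / B) ((n + l - 1) / B - n / B + 1) hq ?_
    · have h2 : l ≤ B * ((n + l - 1) / B - n / B + 1) := by
        have h3 := Nat.div_add_mod n B
        have h4 := Nat.div_add_mod (n + l - 1) B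
        have h5 := Nat.mod_lt (n + l - 1) hB0
        have h6 : n / B ≤ (n + l - 1) / B := Nat.div_le_div_right (by omega)
        obtain ⟨e, he⟩ := Nat.exists_eq_add_of_le h6
        rw [he] at h4 ⊢
        rw [Nat.mul_add] at h4
        rw [Nat.add_sub_cancel_left, Nat.mul_succ]
        omega
      calc a * l + c ≤ a * (B * ((n + l - 1) / B - n / B + 1)) + B * c := by
            have h3 := Nat.mul_le_mul_left a h2
            have h4 := Nat.mul_le_mul_right c (show 1 ≤ B by omega)
            omega
        _ = B * (a * ((n + l - 1) / B - n / B + 1) + c) := by ring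
        _ ≤ B * (d * q) := Nat.mul_le_mul_left B h1
        _ = d * (B * q) := by ring
    · intro j hj
      -- A position of the run in the block of number `n / B + j`.
      obtain ⟨i, hi, hij⟩ : ∃ i < l, (n + i) / B = n / B + j := by
        have h3 := Nat.div_add_mod n B
        have h4 := Nat.mod_lt n hB0
        rcases Nat.eq_zero_or_pos j with rfl | hj0
        · exact ⟨0, by omega, by simp⟩
        · have h5 : (n / B + j) * B ≤ n + l - 1 :=
            (Nat.le_div_iff_mul_le hB0).1 (by omega)
          have h6 : n ≤ (n / B + j) * B := by
            have : (n / B + 1) * B ≤ (n / B + j) * B := Nat.mul_le_mul_right B (by omega)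
            rw [Nat.succ_mul, Nat.mul_comm (n / B)] at this
            omega
          refine ⟨(n / B + j) * B - n, by omega, ?_⟩
          rw [Nat.add_sub_cancel' h6, Nat.mul_div_cancel _ hB0]
      have h7 := hdiv (n + i) (n + i + B * q) (by simp) (h i hi)
      rwa [Nat.add_mul_div_left _ _ hB0, hij] at h7

/-- The set of the positions less than `N` where the bit of weight `2 ^ k` of the letter is set. -/
def letterPlane (W : ℕ → ℕ) (N k : ℕ) : ℕ :=
  concat (fun n => Nat.mod (Nat.div (W n) (Nat.pow 2 k)) 2) 1 N

theorem planes_letterPlane (W : ℕ → ℕ) (N : ℕ) (ks : List ℕ) :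
    Planes W N (ks.map (letterPlane W N)) := by
  intro X hX
  obtain ⟨k, -, rfl⟩ := List.mem_map.1 hX
  refine ⟨fun a => (Nat.mod (Nat.div a (Nat.pow 2 k)) 2).testBit 0, fun i hi => ?_⟩
  rw [letterPlane, testBit_concat (f := fun n => Nat.mod (Nat.div (W n) (Nat.pow 2 k)) 2) one_pos
    fun a => Nat.mod_lt _ (by norm_num)]
  simp [hi, Nat.mod_one]

/-! ### A word on three letters without repetitions of exponent greater than `7/4` -/

/-- The ternary word whose letters are the sums modulo `3` of the entries of
`0120212012102120210` at the places given by the digits in base `19`. -/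
def dejeanWord : ℕ → ℕ := digitSum 19 3 (digit 120212012102120210)

theorem coded_dejeanWord :
    Coded dejeanWord dejeanWord 19 fun a r => (digit 120212012102120210 r + a) % 3 :=
  coded_digitSum (by norm_num) rfl

theorem dejeanWord_lt (n : ℕ) : dejeanWord n < 3 :=
  digitSum_lt (by norm_num) (by norm_num) rfl n

theorem factorSet_dejeanWord_two :
    factorSet dejeanWord 3 2 (26 * 19) = factorSet dejeanWord 3 2 26 := by decide +kernel

theorem factorSet_dejeanWord_three :
    factorSet dejeanWord 3 3 (26 * 19) = factorSet dejeanWord 3 3 26 := by decide +kernel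

theorem syncCheck_dejeanWord : (forceMap (letterPlane dejeanWord 600) [0, 1] fun Xs =>
    syncCheck Xs 19 (26 * 19) 10 9) = true := by decide +kernel

theorem runCheck_dejeanWord : (forceMap (letterPlane dejeanWord 600) [0, 1] fun Xs =>
    runCheck Xs (26 * 19) (fun p => Nat.succ (Nat.div (Nat.mul 3 p) 4)) 4) = true := by
  decide +kernel

/-- A run that is too short for synchronization satisfies the bound if its period is at least `12`. -/
theorem dejeanWord_run_le {p n l : ℕ} (hp : 1 ≤ p)
    (h : ∀ j < l, dejeanWord (n + j) = dejeanWord (n + j + p)) : 4 * l ≤ 3 * p := by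
  have h2 : FactorsBelow dejeanWord 2 26 :=
    coded_dejeanWord.factorsBelow (by norm_num) dejeanWord_lt (by norm_num) factorSet_dejeanWord_two
  have h3 : FactorsBelow dejeanWord 3 26 :=
    coded_dejeanWord.factorsBelow (by norm_num) dejeanWord_lt (by norm_num)
      factorSet_dejeanWord_three
  have hX := planes_letterPlane dejeanWord 600 [0, 1]
  have hs := syncCheck_dejeanWord
  have hr := runCheck_dejeanWord
  rw [forceMap_eq] at hs hr
  have hsync : Synchronized dejeanWord 19 10 :=
    coded_dejeanWord.synchronized (by norm_num) h2 hX (by norm_num) (by norm_num) (by norm_num)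
      (by norm_num) hs
  refine run_bound (a := 4) (c := 0) (d := 3) (by norm_num)
    (fun n n' => digitSum_div_eq (by norm_num) (by norm_num) rfl) hsync (by norm_num) ?_ p n l hp h
  intro n p l hp hl h
  rcases le_or_gt 12 p with hp' | hp'
  · omega
  have e : Nat.succ (Nat.div (Nat.mul 3 p) 4) = 3 * p / 4 + 1 := rfl
  obtain ⟨j, hj, hne⟩ := coded_dejeanWord.exists_ne (by norm_num) h3 hX hr hp (by omega)
    (by omega) (by omega) (by norm_num) n
  have : l ≤ j := by
    by_contra hjl
    exact hne (h j (by omega))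
  omega

/-! ### A word on seven letters with short runs -/

/-- The word on seven letters whose letters are the sums modulo `7` of the entries of `0124613450` at
the places given by the decimal digits. -/
def sourceWord : ℕ → ℕ := digitSum 10 7 (digit 543164210)

theorem coded_sourceWord :
    Coded sourceWord sourceWord 10 fun a r => (digit 543164210 r + a) % 7 :=
  coded_digitSum (by norm_num) rfl

theorem sourceWord_lt (n : ℕ) : sourceWord n < 7 :=
  digitSum_lt (by norm_num) (by norm_num) rfl n

theorem factorSet_sourceWord_two :
    factorSet sourceWord 7 2 (29 * 10) = factorSet sourceWord 7 2 29 := by decide +kernel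

theorem factorSet_sourceWord_three :
    factorSet sourceWord 7 3 (46 * 10) = factorSet sourceWord 7 3 46 := by decide +kernel

theorem factorsBelow_sourceWord_two : FactorsBelow sourceWord 2 29 :=
  coded_sourceWord.factorsBelow (by norm_num) sourceWord_lt (by norm_num) factorSet_sourceWord_two

theorem factorsBelow_sourceWord_three : FactorsBelow sourceWord 3 46 :=
  coded_sourceWord.factorsBelow (by norm_num) sourceWord_lt (by norm_num) factorSet_sourceWord_three

theorem syncCheck_sourceWord : (forceMap (letterPlane sourceWord 500) [0, 1, 2] fun Xs =>
    syncCheck Xs 10 (29 * 10) 8 9) = true := by decide +kernel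

theorem runCheck_sourceWord : (forceMap (letterPlane sourceWord 500) [0, 1, 2] fun Xs =>
    runCheck Xs (46 * 10) (fun p => Nat.div (Nat.succ p) 2) 4) = true := by
  decide +kernel

/-- A run that is too short for synchronization satisfies the bound if its period is at least `15`. -/
theorem sourceWord_run_lt {p n l : ℕ} (hp : 1 ≤ p)
    (h : ∀ j < l, sourceWord (n + j) = sourceWord (n + j + p)) : 2 * l + 1 ≤ p := by
  have hX := planes_letterPlane sourceWord 500 [0, 1, 2]
  have hs := syncCheck_sourceWord
  have hr := runCheck_sourceWord
  rw [forceMap_eq] at hs hr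
  have hsync : Synchronized sourceWord 10 8 :=
    coded_sourceWord.synchronized (by norm_num) factorsBelow_sourceWord_two hX (by norm_num)
      (by norm_num) (by norm_num) (by norm_num) hs
  refine (run_bound (a := 2) (c := 1) (d := 1) (by norm_num)
    (fun n n' => digitSum_div_eq (by norm_num) (by norm_num) rfl) hsync (by norm_num) ?_ p n l hp
    h).trans_eq (one_mul p)
  intro n p l hp hl h
  rcases le_or_gt 15 p with hp' | hp'
  · omega
  have e : Nat.div (Nat.succ p) 2 = (p + 1) / 2 := rfl
  obtain ⟨j, hj, hne⟩ := coded_sourceWord.exists_ne (by norm_num) factorsBelow_sourceWord_three hX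
    hr hp (by omega) (by omega) (by omega) (by norm_num) n
  have : l ≤ j := by
    by_contra hjl
    exact hne (h j (by omega))
  omega

/-! ### Sets of positions in words made of blocks -/

/-- Does `f` hold for all numbers less than `n`? -/
def allBelow (f : ℕ → Bool) (n : ℕ) : Bool :=
  Nat.rec true (fun n ih => branch (f n) ih false) n

theorem of_allBelow {f : ℕ → Bool} {n : ℕ} (h : allBelow f n = true) {i : ℕ} (hi : i < n) :
    f i = true := by
  induction n with
  | zero => omega
  | succ n ih =>
    have h1 : branch (f n) (allBelow f n) false = true := h
    rw [branch_eq] at h1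
    simp only [Bool.if_false_right, Bool.and_eq_true] at h1
    rcases Nat.lt_succ_iff_lt_or_eq.1 hi with hi | rfl
    · exact ih (by simpa using h1.2) hi
    · simpa using h1.1

/-- The letter number `r` of a block over `{0, 1, 2}`, which is given by its decimal digits. -/
def blockLetter (D r : ℕ) : ℕ := Nat.mod (digit D r) 3

/-- The word obtained from `sourceWord` by replacing each letter `a` by the block number `a` in the
list `Ds` of blocks of length `q`. -/
def blockWord (q : ℕ) (Ds : List ℕ) (n : ℕ) : ℕ :=
  blockLetter (Ds.getD (sourceWord (n / q)) 0) (n % q)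

theorem coded_blockWord (q : ℕ) (Ds : List ℕ) :
    Coded (blockWord q Ds) sourceWord q fun a r => blockLetter (Ds.getD a 0) r := fun _ => rfl

theorem blockWord_lt (q : ℕ) (Ds : List ℕ) (n : ℕ) : blockWord q Ds n < 3 :=
  Nat.mod_lt _ (by norm_num)

/-- The set of the positions of the letter `c` in a block. -/
def blockSet (q c D : ℕ) : ℕ := concat (fun r => bif Nat.beq (blockLetter D r) c then 1 else 0) 1 q

theorem testBit_blockSet (q c D i : ℕ) :
    (blockSet q c D).testBit i = (decide (i < q) && decide (blockLetter D i = c)) := by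
  rw [blockSet, testBit_concat (f := fun r => bif Nat.beq (blockLetter D r) c then 1 else 0) one_pos
    fun r => by cases Nat.beq (blockLetter D r) c <;> simp]
  rw [Nat.div_one, Nat.mod_one]
  congr 1
  by_cases h : blockLetter D i = c
  · simp [h]
  · have h1 : Nat.beq (blockLetter D i) c = false := by
      rw [← Bool.not_eq_true]
      exact fun h1 => h (Nat.eq_of_beq_eq_true h1)
    simp [h, h1]

/-- The set of the positions of the letter `c` in the first `N` blocks of a word, from the sets
`P` of its positions in the blocks. -/
def wordSet (q N : ℕ) (P : List ℕ) : ℕ := concat (fun n => P.getD (sourceWord n) 0) q N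

theorem testBit_wordSet {q : ℕ} (hq : 0 < q) (c N : ℕ) {Ds : List ℕ} (hDs : Ds.length = 7) {i : ℕ}
    (hi : i < N * q) :
    (wordSet q N (Ds.map (blockSet q c))).testBit i = decide (blockWord q Ds i = c) := by
  have hget : ∀ n, (Ds.map (blockSet q c)).getD (sourceWord n) 0 =
      blockSet q c (Ds.getD (sourceWord n) 0) := fun n => by
    have := sourceWord_lt n
    have h1 : sourceWord n < Ds.length := by omega
    simp [h1]
  have hlt : ∀ D, blockSet q c D < 2 ^ q := fun D =>
    Nat.lt_pow_two_of_testBit _ fun i hi => by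
      rw [testBit_blockSet]
      simp [Nat.not_lt.2 hi]
  rw [wordSet, testBit_concat hq fun n => by rw [hget]; exact hlt _]
  have h1 : i / q < N := (Nat.div_lt_iff_lt_mul hq).2 hi
  rw [hget, testBit_blockSet]
  simp [h1, Nat.mod_lt i hq, blockWord]

/-- The sets of the positions of the letters `0`, `1`, `2` in the first `N` blocks are passed to
`k`. -/
def withLetterSets (q : ℕ) (Ds : List ℕ) (N : ℕ) (k : List ℕ → Bool) : Bool :=
  forceMap (blockSet q 0) Ds fun P0 => forceMap (blockSet q 1) Ds fun P1 =>
    forceMap (blockSet q 2) Ds fun P2 => forceMap (wordSet q N) [P0, P1, P2] k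

/-- The members of the list `Es` are the sets of the positions of the letters `0`, `1`, `2`, as far
as the positions less than `N` are concerned. -/
structure LetterSets (W : ℕ → ℕ) (N : ℕ) (Es : List ℕ) : Prop where
  length_eq : Es.length = 3
  testBit_eq : ∀ c < 3, ∀ i < N, (Es.getD c 0).testBit i = decide (W i = c)

theorem LetterSets.planes {W : ℕ → ℕ} {N : ℕ} {Es : List ℕ} (h : LetterSets W N Es) :
    Planes W N Es := by
  intro X hX
  obtain ⟨c, hc, rfl⟩ := List.getElem_of_mem hX
  refine ⟨fun a => decide (a = c), fun i hi => ?_⟩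
  change _ = decide (W i = c)
  rw [← h.testBit_eq c (by rw [← h.length_eq]; exact hc) i hi]
  simp [hc]

theorem Planes.tail {W : ℕ → ℕ} {N : ℕ} {Es : List ℕ} (h : Planes W N Es) :
    Planes W N Es.tail := fun X hX => h X (List.mem_of_mem_tail hX)

theorem exists_letterSets {q : ℕ} (hq : 0 < q) {Ds : List ℕ} (hDs : Ds.length = 7) (N : ℕ) :
    ∃ Es, LetterSets (blockWord q Ds) (N * q) Es ∧ ∀ k, withLetterSets q Ds N k = k Es := by
  refine ⟨_, ⟨?_, ?_⟩, fun k => by simp only [withLetterSets, forceMap_eq]; rfl⟩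
  · simp
  · intro c hc i hi
    obtain rfl | rfl | rfl : c = 0 ∨ c = 1 ∨ c = 2 := by omega
    · exact testBit_wordSet hq 0 N hDs hi
    · exact testBit_wordSet hq 1 N hDs hi
    · exact testBit_wordSet hq 2 N hDs hi

/-- The set of the positions less than `M` where the block of length `l` at position `s` of the word
`c` occurs. -/
def occurrences (Es : List ℕ) (c : ℕ → ℕ) (M s l : ℕ) : ℕ :=
  Nat.rec (Nat.sub (Nat.pow 2 M) 1)
    (fun j ih => Nat.land ih (Nat.shiftRight (Es.getD (c (Nat.add s j)) 0) j)) l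

theorem LetterSets.testBit_occurrences {W : ℕ → ℕ} {N : ℕ} {Es : List ℕ} (h : LetterSets W N Es)
    {c : ℕ → ℕ} (hc : ∀ j, c j < 3) {M s l : ℕ} (hN : M + l ≤ N + 1) (i : ℕ) :
    (occurrences Es c M s l).testBit i = true ↔ i < M ∧ ∀ j < l, W (i + j) = c (s + j) := by
  induction l with
  | zero =>
    change (2 ^ M - 1).testBit i = true ↔ _
    simp
  | succ l ih =>
    change (occurrences Es c M s l &&& (Es.getD (c (s + l)) 0) >>> l).testBit i = true ↔ _
    rw [Nat.testBit_and, Bool.and_eq_true, ih (by omega), Nat.testBit_shiftRight]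
    constructor
    · rintro ⟨⟨hi, h1⟩, h2⟩
      rw [h.testBit_eq _ (hc _) _ (by omega), decide_eq_true_eq, Nat.add_comm] at h2
      refine ⟨hi, fun j hj => ?_⟩
      rcases Nat.lt_succ_iff_lt_or_eq.1 hj with hj | rfl
      · exact h1 j hj
      · exact h2
    · rintro ⟨hi, h1⟩
      refine ⟨⟨hi, fun j hj => h1 j (by omega)⟩, ?_⟩
      rw [h.testBit_eq _ (hc _) _ (by omega), decide_eq_true_eq, Nat.add_comm]
      exact h1 l (by omega)

/-! ### Periodic words with long runs -/

/-- Data on the factors which the word with a given period has in common with another word. The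
sequences of numbers are written with a fixed number of decimal digits for each entry (two for
`bounds`, three for the potentials), the first entry in the last digits. -/
structure PeriodicClass where
  /-- The period. -/
  period : ℕ
  /-- The letters in the period, as decimal digits, the last digit being the first letter. -/
  word : ℕ
  /-- The bounds for the lengths of the common factors that start at the places of the period. -/
  bounds : ℕ
  /-- Numbers `V s` such that the sum of the lengths of two consecutive common factors from place `s`
  to place `s'` is at most `3 * period + (V s - V s') / 2`. -/
  potential : ℕ
  /-- Upper bounds for `2 * d + V (s + d)`, where `d` is the length of a common factor at place
  `s`. -/
  potential₁ : ℕ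
  /-- Upper bounds for `2 * d + V₁ (s + d)`, where the `V₁` are the previous bounds. -/
  potential₂ : ℕ

namespace PeriodicClass

/-- The letter at place `j` of the periodic word. -/
def letter (C : PeriodicClass) (j : ℕ) : ℕ := blockLetter C.word (Nat.mod j C.period)

theorem letter_lt (C : PeriodicClass) (j : ℕ) : C.letter j < 3 := Nat.mod_lt _ (by norm_num)

/-- The bound for the length of a common factor that starts at place `s`. -/
def bound (C : PeriodicClass) (s : ℕ) : ℕ :=
  Nat.mod (Nat.div C.bounds (Nat.pow 100 (Nat.mod s C.period))) 100

theorem bound_lt (C : PeriodicClass) (s : ℕ) : C.bound s < 100 := Nat.mod_lt _ (by norm_num)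

/-- The entry at place `s` of a sequence of potentials. -/
def entry (C : PeriodicClass) (V s : ℕ) : ℕ :=
  Nat.mod (Nat.div V (Nat.pow 1000 (Nat.mod s C.period))) 1000

theorem bound_mod (C : PeriodicClass) (s : ℕ) : C.bound (s % C.period) = C.bound s := by
  change Nat.mod (Nat.div _ (Nat.pow 100 (s % C.period % C.period))) 100 = _
  rw [Nat.mod_mod]
  rfl

theorem entry_mod_add (C : PeriodicClass) (V s d : ℕ) :
    C.entry V (s % C.period + d) = C.entry V (s + d) := by
  change Nat.mod (Nat.div _ (Nat.pow 1000 ((s % C.period + d) % C.period))) 1000 = _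
  rw [Nat.mod_add_mod]
  rfl

theorem entry_mod (C : PeriodicClass) (V s : ℕ) : C.entry V (s % C.period) = C.entry V s :=
  C.entry_mod_add V s 0

theorem letter_mod_add (C : PeriodicClass) (s j : ℕ) :
    C.letter (s % C.period + j) = C.letter (s + j) := by
  change blockLetter _ ((s % C.period + j) % C.period) = _
  rw [Nat.mod_add_mod]
  rfl

/-- The set of the positions less than `M` where the periodic word occurs for the length of a period,
starting at a place less than `n`. -/
def occurrencesBelow (C : PeriodicClass) (Es : List ℕ) (M : ℕ) (n : ℕ) : ℕ :=
  Nat.rec 0 (fun s ih => Nat.lor ih (occurrences Es C.letter M s C.period)) n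

/-- The test that the bounds of `C` are correct at the positions less than `M`. -/
def boundsCheck (C : PeriodicClass) (Es : List ℕ) (M : ℕ) : Bool :=
  allBelow (fun s => Nat.beq (occurrences Es C.letter M s (Nat.succ (C.bound s))) 0) C.period

end PeriodicClass

/-- The set of the positions less than `M` where a member of `Cs` of period `p` occurs for the length
of its period. -/
def classSet (Cs : List PeriodicClass) (Es : List ℕ) (M p : ℕ) : ℕ :=
  List.rec 0 (fun C _ ih => bif Nat.beq C.period p then
    Nat.lor (C.occurrencesBelow Es M C.period) ih else ih) Cs

theorem LetterSets.exists_of_classSet {W : ℕ → ℕ} {N : ℕ} {Es : List ℕ} (h : LetterSets W N Es)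
    {Cs : List PeriodicClass} {M p i : ℕ} (hN : M + p ≤ N + 1)
    (hi : (classSet Cs Es M p).testBit i = true) :
    ∃ C ∈ Cs, C.period = p ∧ ∃ s, ∀ j < p, W (i + j) = C.letter (s + j) := by
  induction Cs with
  | nil => simp [classSet] at hi
  | cons C Cs ih =>
    have ih' : (classSet Cs Es M p).testBit i = true → ∃ C' ∈ C :: Cs, C'.period = p ∧
        ∃ s, ∀ j < p, W (i + j) = C'.letter (s + j) := fun h1 => by
      obtain ⟨C', hC', h2⟩ := ih h1
      exact ⟨C', List.mem_cons_of_mem _ hC', h2⟩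
    change (bif Nat.beq C.period p then C.occurrencesBelow Es M C.period ||| classSet Cs Es M p
      else classSet Cs Es M p).testBit i = true at hi
    cases hp : Nat.beq C.period p with
    | false => exact ih' (by simpa [hp] using hi)
    | true =>
      have hp := Nat.eq_of_beq_eq_true hp
      rw [hp] at hi
      simp only [Nat.beq_refl, cond_true, Nat.testBit_or, Bool.or_eq_true] at hi
      rcases hi with hi | hi
      · refine ⟨C, List.mem_cons_self, hp, ?_⟩
        have key : ∀ n, (C.occurrencesBelow Es M n).testBit i = true →
            ∃ s, ∀ j < p, W (i + j) = C.letter (s + j) := by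
          intro n
          induction n with
          | zero => simp [PeriodicClass.occurrencesBelow]
          | succ n ihn =>
            intro h1
            change (C.occurrencesBelow Es M n ||| occurrences Es C.letter M n C.period).testBit i =
              true at h1
            rw [Nat.testBit_or, Bool.or_eq_true, hp] at h1
            rcases h1 with h1 | h1
            · exact ihn h1
            · exact ⟨n, ((h.testBit_occurrences C.letter_lt hN i).1 h1).2⟩
        exact key p hi
      · exact ih' hi

theorem LetterSets.le_bound {W : ℕ → ℕ} {N : ℕ} {Es : List ℕ} (h : LetterSets W N Es)
    {C : PeriodicClass} {M : ℕ} (hC : C.boundsCheck Es M = true) (hp : 1 ≤ C.period)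
    {i s : ℕ} (hi : i < M) (hN : M + C.bound s ≤ N)
    (hl : ∀ j < C.bound s + 1, W (i + j) = C.letter (s + j)) : False := by
  have h1 := Nat.eq_of_beq_eq_true (of_allBelow hC (i := s % C.period) (Nat.mod_lt _ hp))
  rw [C.bound_mod] at h1
  have h2 := (h.testBit_occurrences C.letter_lt (M := M) (s := s % C.period)
    (l := Nat.succ (C.bound s)) (by omega) i).2 ⟨hi, fun j hj => by
      rw [hl j hj, C.letter_mod_add]⟩
  rw [h1] at h2
  simp at h2

/-- The test that every run of period `p < n` and length `p / 2 + 1`, at a position less than `M`,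
belongs to a member of `Cs`; here `n ≤ 2 ^ d`. -/
def classCheck (Cs : List PeriodicClass) (Es : List ℕ) (M n d : ℕ) : Bool :=
  allFrom (fun p => branch (Nat.ble n p) true <| force (tag p (mismatch Es.tail p)) fun X => force (classSet Cs Es M p) fun O =>
    force (Nat.succ (Nat.div p 2)) fun l => covers M O l p 10 1 X) d 1

/-- The test that two different blocks cannot agree on more than a quarter of their length. -/
def blocksCheck (q : ℕ) (Ds : List ℕ) : Bool :=
  allBelow (fun a => allBelow (fun b =>
    force (tag 0 (Nat.lor
      (Nat.xor (blockSet q 1 (Ds.getD a 0)) (blockSet q 1 (Ds.getD b 0)))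
      (Nat.xor (blockSet q 2 (Ds.getD a 0)) (blockSet q 2 (Ds.getD b 0))))) fun X =>
      force (Nat.div q 4) fun e => covers (Nat.sub q e) 0 (Nat.succ e) 0 10 1 X) a) 7

theorem of_blocksCheck {q : ℕ} {Ds : List ℕ} (h : blocksCheck q Ds = true) {a b : ℕ} (ha : a < 7)
    (hb : b < 7) (hab : a ≠ b) {r l : ℕ} (hr : r + l ≤ q)
    (hl : ∀ j < l, blockLetter (Ds.getD a 0) (r + j) = blockLetter (Ds.getD b 0) (r + j)) :
    4 * l ≤ q := by
  wlog hlt : b < a generalizing a b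
  · exact this hb ha hab.symm (fun j hj => (hl j hj).symm) (by omega)
  by_contra hq
  have h1 := of_allBelow (of_allBelow h ha) hlt
  simp only [force_eq] at h1
  have e1 : Nat.div q 4 = q / 4 := rfl
  have e2 : Nat.sub q (q / 4) = q - q / 4 := rfl
  rw [e1, e2] at h1
  have hD : ∀ i, (untag (tag 0 ((blockSet q 1 (Ds.getD a 0) ^^^ blockSet q 1 (Ds.getD b 0)) |||
      (blockSet q 2 (Ds.getD a 0) ^^^ blockSet q 2 (Ds.getD b 0))))).testBit i = true →
      ∃ j < 1, i + j < q →
        blockLetter (Ds.getD a 0) (i + j) ≠ blockLetter (Ds.getD b 0) (i + j) := by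
    refine fun i hi => ⟨0, one_pos, fun _ he => ?_⟩
    rw [Nat.add_zero] at he
    rw [untag_tag] at hi
    simp only [Nat.testBit_or, Nat.testBit_xor, testBit_blockSet, he] at hi
    simp at hi
  rcases of_covers (P := fun x => x < q →
      blockLetter (Ds.getD a 0) x ≠ blockLetter (Ds.getD b 0) x) (by omega) hD h1
      (i := r) (by omega) with h2 | ⟨j, hj, h2⟩
  · simp at h2
  · exact h2 (by omega) (hl j (by omega))

/-! ### Repetitions in products of factors -/

section Repetitions

variable {α : Type} {w : ℕ → α}

theorem IsFactor.take {x : List α} (h : IsFactor w x) (k : ℕ) : IsFactor w (x.take k) := by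
  obtain ⟨n, m, rfl⟩ := h
  exact ⟨n, min k m, by rw [← List.map_take, List.take_range]⟩

theorem IsFactor.drop {x : List α} (h : IsFactor w x) (k : ℕ) : IsFactor w (x.drop k) := by
  obtain ⟨n, m, rfl⟩ := h
  refine ⟨n + k, m - k, List.ext_getElem (by simp) fun j h1 h2 => ?_⟩
  simp [Nat.add_assoc]

theorem IsProductOfFactors.take {i : ℕ} {x : List α} (h : IsProductOfFactors i w x) (k : ℕ) :
    IsProductOfFactors i w (x.take k) := by
  obtain ⟨l, rfl, hl, rfl⟩ := h
  induction l generalizing k with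
  | nil => exact ⟨[], rfl, by simp, by simp⟩
  | cons f l ih =>
    obtain ⟨l', h1, h2, h3⟩ := ih (k - f.length) (fun u hu => hl u (List.mem_cons_of_mem _ hu))
    refine ⟨f.take k :: l', by simp [h1], fun u hu => ?_, ?_⟩
    · rcases List.mem_cons.1 hu with rfl | hu
      · exact (hl f List.mem_cons_self).take k
      · exact h2 u hu
    · rw [List.flatten_cons, List.take_append, h3, List.flatten_cons]

theorem IsProductOfFactors.drop {i : ℕ} {x : List α} (h : IsProductOfFactors i w x) (k : ℕ) :
    IsProductOfFactors i w (x.drop k) := by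
  obtain ⟨l, rfl, hl, rfl⟩ := h
  induction l generalizing k with
  | nil => exact ⟨[], rfl, by simp, by simp⟩
  | cons f l ih =>
    obtain ⟨l', h1, h2, h3⟩ := ih (k - f.length) (fun u hu => hl u (List.mem_cons_of_mem _ hu))
    refine ⟨f.drop k :: l', by simp [h1], fun u hu => ?_, ?_⟩
    · rcases List.mem_cons.1 hu with rfl | hu
      · exact (hl f List.mem_cons_self).drop k
      · exact h2 u hu
    · rw [List.flatten_cons, List.drop_append, h3, List.flatten_cons]

theorem IsProductOfFactors.infix {i : ℕ} {x y : List α} (h : IsProductOfFactors i w x)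
    (hy : y <:+: x) : IsProductOfFactors i w y := by
  obtain ⟨a, b, rfl⟩ := hy
  have := (h.drop a.length).take y.length
  simpa using this

theorem IsProductOfFactors.exists_chain {i : ℕ} {x : List α} (h : IsProductOfFactors i w x)
    {u : ℕ → α} {s : ℕ} (hu : ∀ j, (hj : j < x.length) → x[j] = u (s + j)) :
    ∃ ds : List ℕ, ds.length = i ∧ ds.sum = x.length ∧ Chain w u s ds := by
  obtain ⟨l, rfl, hl, rfl⟩ := h
  refine ⟨l.map List.length, by simp, by simp, ?_⟩
  induction l generalizing s with
  | nil => trivial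
  | cons f l ih =>
    refine ⟨?_, ih (fun v hv => hl v (List.mem_cons_of_mem _ hv)) fun j hj => ?_⟩
    · obtain ⟨n, m, rfl⟩ := hl f List.mem_cons_self
      refine ⟨n, fun j hj => ?_⟩
      have hj' : j < m := by simpa using hj
      rw [← hu j (by simp; omega)]
      simp [hj']
    · have := hu (f.length + j) (by simpa using hj)
      simpa [Nat.add_assoc] using this

theorem getElem_repetition {p e : List α} (hp : p ≠ []) (he : e <+: p ++ e) (j : ℕ)
    (hj : j < (p ++ e).length) :
    (p ++ e)[j] = p[j % p.length]'(Nat.mod_lt _ (List.length_pos_iff.2 hp)) := by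
  have hp0 := List.length_pos_iff.2 hp
  induction j using Nat.strong_induction_on with
  | _ j ih =>
    rcases lt_or_ge j p.length with h | h
    · simp [h, Nat.mod_eq_of_lt h]
    · have h1 : j - p.length < e.length := by
        rw [List.length_append] at hj
        omega
      have h2 : (p ++ e)[j] = (p ++ e)[j - p.length]'(by omega) := by
        rw [List.getElem_append_right h]
        exact he.getElem h1
      rw [h2, ih _ (by omega)]
      congr 1
      exact (Nat.mod_eq_sub_mod h).symm

/-- The exponents of the repetitions in products of `i` factors are bounded by `r` if the total length
of a chain of `i` factors along a `P`-periodic word is bounded by `r * P`. -/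
theorem isPlusFree_of_chain {i : ℕ} {r : ℝ}
    (h : ∀ P (u : ℕ → α) s (ds : List ℕ), 1 ≤ P → (∀ j, u (j + P) = u j) → ds.length = i →
      Chain w u s ds → (ds.sum : ℝ) ≤ r * P) {x : List α} (hx : IsProductOfFactors i w x) :
    IsPlusFree r x := by
  rintro p e ⟨hpe, hp, he⟩
  have hp0 := List.length_pos_iff.2 hp
  obtain ⟨ds, h1, h2, h3⟩ := (hx.infix hpe).exists_chain (s := 0)
    (u := fun j => p[j % p.length]'(Nat.mod_lt _ hp0))
    fun j hj => by rw [getElem_repetition hp he]; simp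
  have := h p.length _ 0 ds hp0 (fun j => by simp) h1 h3
  rw [not_lt, repExponent, div_le_iff₀ (by exact_mod_cast hp0), ← h2]
  exact this

end Repetitions

/-! ### Chains along periodic words -/

section Chains

variable {W : ℕ → ℕ}

theorem Chain.congr {u u' : ℕ → ℕ} {s s' : ℕ} {ds : List ℕ} (h : Chain W u s ds)
    (hu : ∀ j, u (s + j) = u' (s' + j)) : Chain W u' s' ds := by
  induction ds generalizing s s' with
  | nil => trivial
  | cons d ds ih =>
    obtain ⟨⟨n, hn⟩, h2⟩ := h
    refine ⟨⟨n, fun j hj => by rw [hn j hj, hu]⟩, ih h2 fun j => ?_⟩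
    rw [Nat.add_assoc, hu, Nat.add_assoc]

theorem Chain.exists_seg {u : ℕ → ℕ} {s d : ℕ} {ds : List ℕ} (h : Chain W u s ds) (hd : d ∈ ds) :
    ∃ x, Seg W u (s + x) d := by
  induction ds generalizing s with
  | nil => simp at hd
  | cons d' ds ih =>
    rcases List.mem_cons.1 hd with rfl | hd
    · exact ⟨0, h.1⟩
    · obtain ⟨x, hx⟩ := ih h.2 hd
      exact ⟨d' + x, by rwa [← Nat.add_assoc]⟩

/-- The properties of a word `W` and a list of periodic classes which are used to bound chains: the
factors of exponent greater than `3/2` belong to these classes, and the bounds of the classes are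
correct. -/
structure Classified (W : ℕ → ℕ) (Cs : List PeriodicClass) : Prop where
  period_pos : ∀ C ∈ Cs, 1 ≤ C.period
  exists_class : ∀ P (u : ℕ → ℕ) s d, 1 ≤ P → (∀ j, u (j + P) = u j) → Seg W u s d →
    3 * P < 2 * d → ∃ C ∈ Cs, C.period = P ∧ ∃ r, ∀ j, u (s + j) = C.letter (r + j)
  le_bound : ∀ C ∈ Cs, ∀ s d, Seg W C.letter s d → d ≤ C.bound s

theorem Classified.chain {Cs : List PeriodicClass} (hW : Classified W Cs) {P : ℕ} (hP : 1 ≤ P)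
    {u : ℕ → ℕ} (hu : ∀ j, u (j + P) = u j) {s : ℕ} {ds : List ℕ} (h : Chain W u s ds) :
    2 * ds.sum ≤ 3 * P * ds.length ∨ ∃ C ∈ Cs, C.period = P ∧ ∃ r, Chain W C.letter r ds := by
  by_cases hd : ∀ d ∈ ds, 2 * d ≤ 3 * P
  · left
    clear h
    induction ds with
    | nil => simp
    | cons d ds ih =>
      have h1 := ih fun d' hd' => hd d' (List.mem_cons_of_mem _ hd')
      have h2 := hd d List.mem_cons_self
      rw [List.sum_cons, List.length_cons]
      nlinarith
  · right
    push Not at hd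
    obtain ⟨d, hd, hlt⟩ := hd
    obtain ⟨x, hx⟩ := h.exists_seg hd
    obtain ⟨C, hC, hCP, r, hr⟩ := hW.exists_class P u _ d hP hu hx hlt
    refine ⟨C, hC, hCP, r + (x * P - x), h.congr fun j => ?_⟩
    have hx : x ≤ x * P := Nat.le_mul_of_pos_right x hP
    have hk : ∀ k j, u (j + k * P) = u j := by
      intro k
      induction k with
      | zero => simp
      | succ k ih => intro j; rw [Nat.succ_mul, ← Nat.add_assoc, hu, ih]
    rw [← hk x, show s + j + x * P = s + x + (x * P - x + j) by omega, hr, Nat.add_assoc]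

/-- The two inequalities between the potentials of a class which are needed at place `s` for a common
factor of length `d`. -/
def PeriodicClass.stepCheck (C : PeriodicClass) (s d : ℕ) : Bool :=
  branch (Nat.ble (Nat.add (Nat.mul 2 d) (C.entry C.potential (Nat.add s d)))
      (C.entry C.potential₁ s))
    (Nat.ble (Nat.add (Nat.mul 2 d) (C.entry C.potential₁ (Nat.add s d))) (C.entry C.potential₂ s))
    false

/-- The test of all the inequalities between the potentials of a class, with a further test `f` at all
places and for all lengths of common factors. -/
def PeriodicClass.potentialCheck (f : PeriodicClass → ℕ → ℕ → Bool) (C : PeriodicClass) : Bool :=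
  branch (Nat.ble 1 C.period) (allBelow (fun s =>
    branch (Nat.ble (C.entry C.potential₂ s) (Nat.add (C.entry C.potential s) (Nat.mul 6 C.period)))
      (force (Nat.succ (C.bound s)) fun b => allBelow
        (fun d => branch (C.stepCheck s d) (f C s d) false) b) false) C.period) false

theorem PeriodicClass.of_potentialCheck {f : PeriodicClass → ℕ → ℕ → Bool} {C : PeriodicClass}
    (h : C.potentialCheck f = true) :
    1 ≤ C.period ∧ ∀ s, C.entry C.potential₂ s ≤ C.entry C.potential s + 6 * C.period ∧
      ∀ d ≤ C.bound s, 2 * d + C.entry C.potential (s + d) ≤ C.entry C.potential₁ s ∧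
        2 * d + C.entry C.potential₁ (s + d) ≤ C.entry C.potential₂ s ∧
        f C (s % C.period) d = true := by
  rw [potentialCheck, branch_eq] at h
  split at h
  swap
  · exact absurd h Bool.false_ne_true
  rename_i hp
  have hp : 1 ≤ C.period := Nat.le_of_ble_eq_true hp
  refine ⟨hp, fun s => ?_⟩
  have h1 := of_allBelow h (Nat.mod_lt s hp)
  simp only [branch_eq, force_eq, C.entry_mod, C.bound_mod] at h1
  split at h1
  swap
  · exact absurd h1 Bool.false_ne_true
  rename_i h2
  refine ⟨Nat.le_of_ble_eq_true h2, fun d hd => ?_⟩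
  have h3 := of_allBelow h1 (Nat.lt_succ_of_le hd)
  simp only [stepCheck, branch_eq, C.entry_mod] at h3
  split at h3
  swap
  · exact absurd h3 Bool.false_ne_true
  rename_i h4
  split at h3
  swap
  · exact absurd h3 Bool.false_ne_true
  rename_i h5
  refine ⟨?_, ?_, h3⟩
  · rw [← C.entry_mod_add]
    exact Nat.le_of_ble_eq_true h4
  · rw [← C.entry_mod_add]
    exact Nat.le_of_ble_eq_true h5

/-- Two consecutive factors have average length at most `3/2` periods, up to a change of the
potential. -/
theorem Classified.two_mul_sum_le {Cs : List PeriodicClass} (hW : Classified W Cs)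
    {C : PeriodicClass} (hC : C ∈ Cs) {f : PeriodicClass → ℕ → ℕ → Bool}
    (hf : C.potentialCheck f = true) (k : ℕ) {s : ℕ} {ds : List ℕ} (hds : ds.length = 2 * k)
    (h : Chain W C.letter s ds) :
    2 * ds.sum ≤ C.entry C.potential s + 6 * C.period * k := by
  have hpot := (PeriodicClass.of_potentialCheck hf).2
  induction k generalizing s ds with
  | zero =>
    obtain rfl : ds = [] := List.length_eq_zero_iff.1 (by simpa using hds)
    simp
  | succ k ih =>
    obtain _ | ⟨d₁, _ | ⟨d₂, ds⟩⟩ := ds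
    · simp at hds
    · simp at hds; omega
    obtain ⟨h1, h2, h3⟩ := h
    have h4 := ih (by simp at hds; omega) h3
    have h5 := (hpot s).1
    have h6 := ((hpot s).2 d₁ (hW.le_bound C hC _ _ h1)).2.1
    have h7 := ((hpot (s + d₁)).2 d₂ (hW.le_bound C hC _ _ h2)).1
    simp only [List.sum_cons]
    rw [Nat.mul_succ]
    omega

/-- The potential at place `s` is at most half the period. -/
def PeriodicClass.evenCheck (C : PeriodicClass) (s _ : ℕ) : Bool :=
  Nat.ble (Nat.mul 2 (C.entry C.potential s)) C.period

/-- Three consecutive factors, the first one having length `d` and starting at place `s`, have total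
length at most `14/3` periods, even with the final potential added. -/
def PeriodicClass.oddCheck (C : PeriodicClass) (s d : ℕ) : Bool :=
  Nat.ble (Nat.mul 3 (Nat.add (Nat.mul 2 d) (C.entry C.potential₂ (Nat.add s d))))
    (Nat.mul 28 C.period)

theorem Classified.even_bound {Cs : List PeriodicClass} (hW : Classified W Cs)
    (hf : ∀ C ∈ Cs, C.potentialCheck PeriodicClass.evenCheck = true) {P : ℕ} (hP : 1 ≤ P)
    {u : ℕ → ℕ} (hu : ∀ j, u (j + P) = u j) {s k : ℕ} {ds : List ℕ} (hds : ds.length = 2 * k)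
    (h : Chain W u s ds) : 4 * ds.sum ≤ (12 * k + 1) * P := by
  rcases hW.chain hP hu h with h1 | ⟨C, hC, rfl, r, h1⟩
  · rw [hds] at h1
    nlinarith
  · have h2 := hW.two_mul_sum_le hC (hf C hC) k hds h1
    obtain ⟨hp, h3⟩ := PeriodicClass.of_potentialCheck (hf C hC)
    have h4 : 2 * C.entry C.potential (r % C.period) ≤ C.period :=
      Nat.le_of_ble_eq_true ((h3 r).2 0 (Nat.zero_le _)).2.2
    rw [C.entry_mod] at h4
    nlinarith

theorem Classified.odd_bound {Cs : List PeriodicClass} (hW : Classified W Cs)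
    (hf : ∀ C ∈ Cs, C.potentialCheck PeriodicClass.oddCheck = true) {P : ℕ} (hP : 1 ≤ P)
    {u : ℕ → ℕ} (hu : ∀ j, u (j + P) = u j) {s k : ℕ} {ds : List ℕ} (hds : ds.length = 2 * k + 3)
    (h : Chain W u s ds) : 6 * ds.sum ≤ (18 * k + 28) * P := by
  rcases hW.chain hP hu h with h1 | ⟨C, hC, rfl, r, h1⟩
  · rw [hds] at h1
    nlinarith
  · obtain _ | ⟨d₁, _ | ⟨d₂, _ | ⟨d₃, ds⟩⟩⟩ := ds
    · simp at hds
    · simp at hds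
    · simp at hds
    obtain ⟨g1, g2, g3, g4⟩ := h1
    have h2 := hW.two_mul_sum_le hC (hf C hC) k (by simpa using hds) g4
    obtain ⟨hp, hpot⟩ := PeriodicClass.of_potentialCheck (hf C hC)
    have h3 := ((hpot (r + d₁)).2 d₂ (hW.le_bound C hC _ _ g2)).2.1
    have h4 := ((hpot (r + d₁ + d₂)).2 d₃ (hW.le_bound C hC _ _ g3)).1
    have h5 : 3 * (2 * d₁ + C.entry C.potential₂ (r % C.period + d₁)) ≤ 28 * C.period :=
      Nat.le_of_ble_eq_true ((hpot r).2 d₁ (hW.le_bound C hC _ _ g1)).2.2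
    rw [C.entry_mod_add] at h5
    simp only [List.sum_cons]
    nlinarith

end Chains

/-! ### The long runs of words made of blocks -/

section BlockWord

variable {q : ℕ} {Ds : List ℕ}

/-- Two blocks at the distance of a run agree if they are different only on a quarter of their
length, so a run whose period is a multiple of `q` comes from a run of `sourceWord`, with at most a
quarter of a block added on both sides. -/
theorem blockWord_run_le (hq : 0 < q) (hb : blocksCheck q Ds = true) {n p l : ℕ} (hp : 1 ≤ p)
    (h : ∀ j < l, blockWord q Ds (n + j) = blockWord q Ds (n + j + q * p)) : 2 * l ≤ q * p := by
  rcases Nat.eq_zero_or_pos l with rfl | hl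
  · simp
  -- The part of the run in a single block.
  have hblock : ∀ b r e, (∀ j < e, ∃ i < l, n + i = q * b + r + j) → r + e ≤ q →
      sourceWord b ≠ sourceWord (b + p) → 4 * e ≤ q := by
    intro b r e hrun hre hne
    refine of_blocksCheck hb (sourceWord_lt b) (sourceWord_lt (b + p)) hne hre fun j hj => ?_
    obtain ⟨i, hi, hij⟩ := hrun j hj
    have h1 := h i hi
    rw [hij] at h1
    have e1 : (q * b + r + j) / q = b := by
      rw [Nat.add_assoc, Nat.mul_add_div hq, Nat.div_eq_of_lt (by omega), Nat.add_zero]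
    have e2 : (q * b + r + j) % q = r + j := by
      rw [Nat.add_assoc, Nat.mul_add_mod, Nat.mod_eq_of_lt (by omega)]
    simpa only [blockWord, Nat.add_mul_div_left _ _ hq, Nat.add_mul_mod_self_left, e1, e2] using h1
  have hn := Nat.div_add_mod n q
  have hn' := Nat.mod_lt n hq
  have hm := Nat.div_add_mod (n + l - 1) q
  have hm' := Nat.mod_lt (n + l - 1) hq
  have hle : n / q ≤ (n + l - 1) / q := Nat.div_le_div_right (by omega)
  generalize n / q = a at *
  generalize (n + l - 1) / q = b at *
  generalize n % q = r at *
  generalize (n + l - 1) % q = s at *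
  obtain ⟨k, rfl⟩ := Nat.exists_eq_add_of_le hle
  -- It suffices to find a run of `sourceWord` of length `l'` such that `4 * l ≤ 4 * q * l' + 2 * q`.
  suffices hs : ∃ a' l', (∀ j < l', sourceWord (a' + j) = sourceWord (a' + j + p)) ∧
      2 * l ≤ q * (2 * l' + 1) by
    obtain ⟨a', l', h1, h2⟩ := hs
    exact h2.trans (Nat.mul_le_mul_left q (sourceWord_run_lt hp h1))
  rcases Nat.eq_zero_or_pos k with rfl | hk
  · -- The run is contained in a block.
    rw [Nat.add_zero] at hm
    by_cases he : sourceWord a = sourceWord (a + p)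
    · refine ⟨a, 1, fun j hj => ?_, by omega⟩
      obtain rfl : j = 0 := by omega
      exact he
    · have := hblock a r l (fun j hj => ⟨j, hj, by omega⟩) (by omega) he
      exact ⟨a, 0, by simp, by omega⟩
  · obtain ⟨k, rfl⟩ : ∃ k', k = k' + 1 := ⟨k - 1, by omega⟩
    have hqk : q * (a + (k + 1)) = q * a + q * k + q := by ring
    rw [hqk] at hm
    -- The blocks between the first and the last one are completely contained in the run.
    have hmid : ∀ j < k, sourceWord (a + 1 + j) = sourceWord (a + 1 + j + p) := by
      intro j hj
      by_contra hne
      have hjk : q * (j + 1) ≤ q * k := Nat.mul_le_mul_left q hj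
      have e1 : q * (a + 1 + j) = q * a + q * (j + 1) := by ring
      have := hblock (a + 1 + j) 0 q (fun i hi => ⟨q * (a + 1 + j) + i - n, by
        rw [e1]; rw [Nat.mul_succ] at hjk ⊢; omega, by
        rw [e1]; rw [Nat.mul_succ] at hjk ⊢; omega⟩) (by omega) hne
      omega
    have hfst : sourceWord a ≠ sourceWord (a + p) → 4 * (q - r) ≤ q := fun hne =>
      hblock a r (q - r) (fun j hj => ⟨j, by omega, by omega⟩) (by omega) hne
    have hlst : sourceWord (a + (k + 1)) ≠ sourceWord (a + (k + 1) + p) → 4 * (s + 1) ≤ q :=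
      fun hne => hblock (a + (k + 1)) 0 (s + 1)
        (fun j hj => ⟨q * (a + (k + 1)) + j - n, by omega, by omega⟩) (by omega) hne
    by_cases h1 : sourceWord a = sourceWord (a + p) <;>
      by_cases h2 : sourceWord (a + (k + 1)) = sourceWord (a + (k + 1) + p)
    · refine ⟨a, k + 2, fun j hj => ?_, ?_⟩
      · obtain rfl | ⟨j, rfl⟩ : j = 0 ∨ ∃ j', j = j' + 1 := by cases j <;> simp
        · exact h1
        · rcases lt_or_ge j k with hjk | hjk
          · have := hmid j hjk
            rwa [Nat.add_assoc a, Nat.add_comm 1 j] at this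
          · obtain rfl : j = k := by omega
            exact h2
      · have : q * (2 * (k + 2) + 1) = 2 * (q * k) + 5 * q := by ring
        omega
    · refine ⟨a, k + 1, fun j hj => ?_, ?_⟩
      · obtain rfl | ⟨j, rfl⟩ : j = 0 ∨ ∃ j', j = j' + 1 := by cases j <;> simp
        · exact h1
        · have := hmid j (by omega)
          rwa [Nat.add_assoc a, Nat.add_comm 1 j] at this
      · have := hlst h2
        have : q * (2 * (k + 1) + 1) = 2 * (q * k) + 3 * q := by ring
        omega
    · refine ⟨a + 1, k + 1, fun j hj => ?_, ?_⟩
      · rcases lt_or_ge j k with hjk | hjk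
        · exact hmid j hjk
        · obtain rfl : j = k := by omega
          rwa [Nat.add_assoc a, Nat.add_comm 1 j]
      · have := hfst h1
        have : q * (2 * (k + 1) + 1) = 2 * (q * k) + 3 * q := by ring
        omega
    · refine ⟨a + 1, k, hmid, ?_⟩
      have := hfst h1
      have := hlst h2
      have : q * (2 * k + 1) = 2 * (q * k) + q := by ring
      omega

/-- Here `m` is the length of synchronizing windows. Runs of period at least `2 * m` are synchronized
if they are longer than half their period, and then `blockWord_run_le` excludes them. The runs of
smaller period occur, with windows of length at most `3 * m`, at one of the first `46 * q` positions,
because the factors of `sourceWord` of length `3` occur at the first `46` positions; three more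
blocks contain these windows. For synchronization, the factors of length `2` are enough. -/
theorem classified_blockWord {m d d' : ℕ} {Cs : List PeriodicClass} (hDs : Ds.length = 7)
    (hq : 50 ≤ q) (hm : 1 ≤ m) (hmq : 3 * m ≤ 2 * q + 1) (hd : 29 * q ≤ 2 ^ d)
    (hd' : 2 * m ≤ 2 ^ d') (hpos : ∀ C ∈ Cs, 1 ≤ C.period)
    (hblocks : blocksCheck q Ds = true)
    (hsync : withLetterSets q Ds 49 (fun Es => syncCheck Es.tail q (29 * q) m d) = true)
    (hclass : withLetterSets q Ds 49 (fun Es => classCheck Cs Es (46 * q) (2 * m) d') = true)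
    (hbounds : withLetterSets q Ds 49 (fun Es => Cs.all fun C => C.boundsCheck Es (46 * q)) = true) :
    Classified (blockWord q Ds) Cs := by
  have hq0 : 0 < q := by omega
  obtain ⟨Es, hEs, hk⟩ := exists_letterSets hq0 hDs 49
  rw [hk] at hsync hclass hbounds
  have hcoded := coded_blockWord q Ds
  have hsync := hcoded.synchronized hq0 factorsBelow_sourceWord_two hEs.planes.tail hm (by omega)
    (by omega) hd hsync
  refine ⟨hpos, ?_, ?_⟩
  · rintro P u s l hP hu ⟨n, hn⟩ hl
    have hrun : ∀ j < l - P, blockWord q Ds (n + j) = blockWord q Ds (n + j + P) := fun j hj => by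
      rw [hn j (by omega), Nat.add_assoc, hn (j + P) (by omega), ← Nat.add_assoc, hu]
    rcases lt_or_ge P (2 * m) with hPm | hPm
    · obtain ⟨a, ha, -, hWa⟩ := hcoded.exists_window hq0 factorsBelow_sourceWord_three n
      have h1 := of_allFrom hclass hP (by omega)
      simp only [branch_eq, force_eq] at h1
      split at h1
      · rename_i h2
        have := Nat.le_of_ble_eq_true h2
        omega
      have e1 : Nat.succ (Nat.div P 2) = P / 2 + 1 := rfl
      rw [e1] at h1
      rcases of_covers_mismatch hEs.planes.tail (by omega) (by omega) h1 ha with h2 | ⟨j, hj, h2⟩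
      · obtain ⟨C, hC, hCP, r, hr⟩ := hEs.exists_of_classSet (by omega) h2
        refine ⟨C, hC, hCP, r, ?_⟩
        have h3 : ∀ j < P, u (s + j) = C.letter (r + j) := fun j hj => by
          rw [← hn j (by omega), ← hWa j (by omega), hr j hj]
        intro j
        induction j using Nat.strong_induction_on with
        | _ j ih =>
          rcases lt_or_ge j P with hj | hj
          · exact h3 j hj
          · have h4 := ih (j - P) (by omega)
            have h5 := hu (s + (j - P))
            rw [show s + (j - P) + P = s + j by omega, h4] at h5
            rw [h5, ← C.letter_mod_add r j, ← C.letter_mod_add r (j - P)]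
            simp only [PeriodicClass.letter]
            congr 1
            have h6 : r % C.period + j = r % C.period + (j - P) + C.period := by omega
            rw [h6]
            exact (Nat.add_mod_right _ _).symm
      · rw [hWa j (by omega), Nat.add_assoc, hWa (j + P) (by omega), ← Nat.add_assoc] at h2
        exact absurd (hrun j (by omega)) h2
    · obtain ⟨p, rfl⟩ := hsync n P fun j hj => by
        rw [hrun j (by omega), Nat.add_right_comm]
      have := blockWord_run_le hq0 hblocks (Nat.pos_of_ne_zero fun h0 => by simp [h0] at hP) hrun
      omega
  · rintro C hC s l ⟨n, hn⟩
    by_contra hl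
    obtain ⟨a, ha, -, hWa⟩ := hcoded.exists_window hq0 factorsBelow_sourceWord_three n
    have hCb := C.bound_lt s
    refine hEs.le_bound (List.all_eq_true.1 hbounds C hC) (hpos C hC) ha (s := s) (by omega)
      fun j hj => ?_
    rw [hWa j (by omega), hn j (by omega)]

end BlockWord

/-! ### The words for two or more factors -/

/-- The blocks of the word for even numbers of factors, written backwards. -/
def evenBlocks : List ℕ := [
  121021201020121012021201210201021202101210201021201210212010201210212021012102120121012021201020121012021201210201021201020121020102120121021202101210212010201210120210121020102120121012021,
  121021201020121021202101210201021201210120212010201210120212012102010212021012102120102012101202101210201021201210212010201210212021012102120121012021201210201021201020121020102120121012021,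
  2012102120210121021201020121012021012102010212012102120102012102120210121021201210120212012102010212021012102010212012101202120102012101202120121021202101210201021201020121020102120121012021,
  2012102120102012101202101210201021201210212021012102120102012101202120121020102120210121020102120121021201020121021202101210212012101202120102012101202101210201021201020121020102120121012021,
  2010201210120212012102010212021012102120102012101202101210201021201210120212012102120102012102010212021012102120121012021201020121012021201210201021201020121020102120210121020102120121012021,
  2012102120102012102120210121021201210120212010201210120212012102120210121020102120121012021012102120102012102010212021012102010212010201210120212012102120210121021201020121020102120121012021,
  2010201210120212012102120210121020102120102012102010212021012102120121012021201020121012021012102010212010201210212021012102120121012021201210201021202101210201021201020121020102120121012021]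

/-- The classes of the factors of exponent greater than `3/2` of the word for even numbers of
factors. -/
def evenClasses : List PeriodicClass := [
  ⟨3, 210, 40504,
    0, 8010008,
    16018018⟩,
  ⟨3, 120, 40504,
    0, 8010008,
    16018018⟩,
  ⟨4, 2010, 7060706,
    2000002000, 14012014012,
    26024026024⟩,
  ⟨4, 1210, 6070607,
    2000002, 12014012014,
    24026024026⟩,
  ⟨4, 2120, 6070607,
    2000002, 12014012014,
    24026024026⟩,
  ⟨6, 212010, 110607080910,
    0, 22012014016018020,
    34024026028030032⟩,
  ⟨6, 120210, 101106070809,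
    0, 20022012014016018,
    32034024026028030⟩,
  ⟨6, 201210, 91011060708,
    0, 18020022012014016,
    30032034024026028⟩,
  ⟨8, 21201210, 1112131415111213,
    2004000002004, 22024026028030022024026,
    44046048050052048050052⟩,
  ⟨11, 12102120210, 1314151617181920101112,
    0, 26028030032034036038040020022024,
    48050052054056058060062042044046⟩,
  ⟨11, 12021201210, 1011121314151617181920,
    0, 20022024026028030032034036038040,
    42044046048050052054056058060062⟩,
  ⟨12, 212012102010, 141516171816171819111213,
    0, 28030032034036032034036038022024026,
    52054056058060062064066068046048050⟩,
  ⟨12, 201210212010, 131415161718192021221112,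
    0, 26028030032034036038040042044022024,
    50052054056058060062064066068046048⟩,
  ⟨15, 212021012102010, 252627281415161718192021222324,
    0, 50052054056028030032034036038040042044046048,
    80082084086058060062064066068070072074076078⟩,
  ⟨15, 201210120212010, 161718192021222324252627282915,
    0, 32034036038040042044046048050052054056058030,
    62064066068070072074076078080082084086088060⟩,
  ⟨16, 2120102012102010, 27282930311617181920212223242526,
    0, 54056058060062032034036038040042044046048050052,
    86088090092094064066068070072074076078080082084⟩]

theorem even_blocksCheck : blocksCheck 190 evenBlocks = true := by
  decide +kernel

theorem even_syncCheck : withLetterSets 190 evenBlocks 49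
    (fun Es => syncCheck Es.tail 190 (29 * 190) 112 13) = true := by
  decide +kernel

theorem even_classCheck : withLetterSets 190 evenBlocks 49
    (fun Es => classCheck evenClasses Es (46 * 190) (2 * 112) 8) = true := by
  decide +kernel

theorem even_boundsCheck : withLetterSets 190 evenBlocks 49
    (fun Es => evenClasses.all fun C => C.boundsCheck Es (46 * 190)) = true := by
  decide +kernel

theorem even_potentialCheck : (evenClasses.all
    fun C => C.potentialCheck PeriodicClass.evenCheck) = true := by
  decide +kernel

theorem classified_even : Classified (blockWord 190 evenBlocks) evenClasses :=
  classified_blockWord (m := 112) (d := 13) (d' := 8) rfl (by norm_num) (by norm_num) (by norm_num)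
    (by norm_num) (by norm_num)
    (fun C hC => (PeriodicClass.of_potentialCheck
      (List.all_eq_true.1 even_potentialCheck C hC)).1)
    even_blocksCheck even_syncCheck even_classCheck even_boundsCheck

/-- The blocks of the word for odd numbers of factors, written backwards. -/
def oddBlocks : List ℕ := [
  2101210201202120102101202120121020102101202102012021201021012102012021012102010212012102010210120212012102012021201021012021020120210121020102120121020120210121020102101202102012021201021012102010212012102010210120212012102012021201021012102012021012102010210120210201021201210201202120102101202120121020102101202102012021012102010212012102012021201021012102012021012102010210120210201,
  20212010210121020102120121020102101202102010210121020120210121020102120121020120212010210120210201202101210201021012021201210201202120102101210201021201210201021012021020120212010210120212012102012021012102010210120210201021201210201202120102101202120121020102101202102012021201021012102010212012102010210120212012102012021201021012102012021012102010212012102012021012102010210120210201,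
  20212010210121020102120121020102101202120121020120212010210121020120210121020102101202102010210121020120212010210120212012102010210120210201021201210201202120102101210201202101210201021201210201021012021020120212010210120212012102012021012102010210120210201021201210201202120102101202102012021012102010210120212012102012021201021012102012021012102010212012102012021012102010210120210201,
  20212010210121020102120121020102101202120121020120212010210121020120210121020102101202102010212012102012021201021012021020120210121020102101202120121020120212010210121020102120121020102101202102010210121020120210121020102120121020120212010210120212012102010210120210201202120102101210201202101210201021012021201210201202120102101202102012021012102010212012102012021012102010210120210201,
  20212010210121020102120121020102101202120121020120212010210121020120210121020102120121020120210121020102101202102010210121020120212010210120212012102010210120210201202120102101210201202101210201021012021201210201202120102101210201021201210201021012021020120212010210120212012102012021012102010210120210201021201210201202120102101202102012021012102010212012102012021012102010210120210201,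
  2101210201202120102101202120121020102101202102012021201021012102012021012102010210120212012102012021201021012021020102120121020120210121020102101202102012021201021012102010212012102010210120210201021012102012021012102010212012102012021201021012021020120210121020102101202120121020120212010210121020102120121020102101202102010210121020120212010210120212012102012021012102010210120210201,
  2101210201202120102101202120121020102101202102012021201021012102012021012102010212012102012021201021012021020120210121020102101202120121020120212010210121020102120121020102101202102010210121020120210121020102120121020120212010210120212012102010210120210201202120102101210201202101210201021201210201021012021201210201202120102101202102012021012102010212012102012021012102010210120210201]

/-- The classes of the factors of exponent greater than `3/2` of the word for odd numbers of
factors. -/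
def oddClasses : List PeriodicClass := [
  ⟨3, 210, 50405,
    2, 10008010,
    18018020⟩,
  ⟨3, 120, 40505,
    2000, 8010010,
    18020018⟩,
  ⟨4, 2010, 7040506,
    0, 14008010012,
    22016018020⟩,
  ⟨4, 1210, 4050607,
    0, 8010012014,
    16018020022⟩,
  ⟨4, 2120, 4050607,
    0, 8010012014,
    16018020022⟩,
  ⟨6, 120210, 80907080910,
    2, 16018014016018020,
    34036032034036038⟩,
  ⟨6, 201210, 70809100506,
    0, 14016018020010012,
    26028030032022024⟩,
  ⟨7, 2102010, 9101105060708,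
    0, 18020022010012014016,
    32034036024026028030⟩,
  ⟨8, 20120210, 809101112131415,
    0, 16018020022024026028030,
    32034036038040042044046⟩,
  ⟨11, 21012102010, 1617151617131415161715,
    2000000000000000000, 32034030032034026028030032034030,
    60062064066068058060062064066058⟩,
  ⟨12, 212012102010, 222312131415161718192021,
    0, 44046024026028030032034036038040042,
    68070048050052054056058060062064066⟩,
  ⟨12, 210120212010, 111213141516171819202110,
    0, 22024026028030032034036038040042020,
    46048050052054056058060062064066044⟩,
  ⟨12, 121020120210, 171819202122231213141516,
    0, 34036038040042044046024026028030032,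
    58060062064066068070048050052054056⟩,
  ⟨13, 2101202102010, 21222324251314151617181920,
    0, 42044046048050026028030032034036038040,
    68070072074076052054056058060062064066⟩,
  ⟨13, 2012021201210, 13141516171819202122101112,
    0, 26028030032034036038040042044020022024,
    52054056058060062064066068070046048050⟩,
  ⟨18, 210120212012102010, 232425262728293022232425262728293022,
    2004006000000000000000000002004006000, 46048050052054056058060044046048050052054056058060044,
    100102104106108110112114098100102104106108110112114098⟩,
  ⟨18, 210121020120212010, 232425262722232425262728293019202122,
    2004006000000000000000000000000000000000000000, 46048050052054044046048050052054056058060038040042044,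
    106108110112114092094096098100102104106108098100102104⟩,
  ⟨20, 21012021020120212010, 2526272829303132232425262728293021222324,
    2004000000000000000000000000000000000000, 50052054056058060062064046048050052054056058060042044046048,
    110112114116118120122124106108110112114116118120102104106108⟩,
  ⟨24, 212012102012021012102010, 464724252627282930313233343536373839404142434445,
    0, 92094048050052054056058060062064066068070072074076078080082084086088090,
    140142096098100102104106108110112114116118120122124126128130132134136138⟩]

theorem odd_blocksCheck : blocksCheck 386 oddBlocks = true := by
  decide +kernel

theorem odd_syncCheck : withLetterSets 386 oddBlocks 49
    (fun Es => syncCheck Es.tail 386 (29 * 386) 257 14) = true := by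
  decide +kernel

theorem odd_classCheck : withLetterSets 386 oddBlocks 49
    (fun Es => classCheck oddClasses Es (46 * 386) (2 * 257) 10) = true := by
  decide +kernel

theorem odd_boundsCheck : withLetterSets 386 oddBlocks 49
    (fun Es => oddClasses.all fun C => C.boundsCheck Es (46 * 386)) = true := by
  decide +kernel

theorem odd_potentialCheck : (oddClasses.all
    fun C => C.potentialCheck PeriodicClass.oddCheck) = true := by
  decide +kernel

theorem classified_odd : Classified (blockWord 386 oddBlocks) oddClasses :=
  classified_blockWord (m := 257) (d := 14) (d' := 10) rfl (by norm_num) (by norm_num) (by norm_num)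
    (by norm_num) (by norm_num)
    (fun C hC => (PeriodicClass.of_potentialCheck
      (List.all_eq_true.1 odd_potentialCheck C hC)).1)
    odd_blocksCheck odd_syncCheck odd_classCheck odd_boundsCheck

/-! ### The thresholds -/

/-- A number is the minimum of the exponents if it bounds the repetitions for one word from above and
for all words from below. -/
theorem isRT_of_bounds {i k : ℕ} {r : ℝ} {w : ℕ → Fin k}
    (hw : ∀ x, IsProductOfFactors i w x → IsPlusFree r x)
    (hr : ∀ (v : ℕ → Fin k) (s : ℝ),
      (∀ x, IsProductOfFactors i v x → IsPlusFree s x) → r ≤ s) : IsRT i k r :=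
  ⟨⟨w, hw, fun s hs => hr w s hs⟩, fun s ⟨v, hv⟩ => hr v s hv.1⟩

theorem Chain.comp {α β : Type} {w u : ℕ → α} {s : ℕ} {ds : List ℕ} (h : Chain w u s ds)
    (f : α → β) : Chain (fun n => f (w n)) (fun n => f (u n)) s ds := by
  induction ds generalizing s with
  | nil => trivial
  | cons d ds ih => exact ⟨h.1.comp f, ih h.2⟩

/-- The exponents are bounded by `r` if they are so for words of natural numbers. -/
theorem isPlusFree_of_val {W : ℕ → ℕ} (hW : ∀ n, W n < 3) {i : ℕ} {r : ℝ}
    (h : ∀ P (u : ℕ → ℕ) s (ds : List ℕ), 1 ≤ P → (∀ j, u (j + P) = u j) → ds.length = i →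
      Chain W u s ds → (ds.sum : ℝ) ≤ r * P) (x : List (Fin 3))
    (hx : IsProductOfFactors i (fun n => (⟨W n, hW n⟩ : Fin 3)) x) : IsPlusFree r x :=
  isPlusFree_of_chain (fun P u s ds hP hu hds hc =>
    h P (fun j => (u j).val) s ds hP (fun j => by rw [hu]) hds (hc.comp Fin.val)) hx

theorem isRT_one : IsRT 1 3 (7 / 4) := by
  refine isRT_of_bounds (isPlusFree_of_val dejeanWord_lt ?_) fun v s h => (hasRun_ternary v).le h
  intro P u s ds hP hu hds hc
  obtain ⟨d, rfl⟩ := List.length_eq_one_iff.1 hds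
  obtain ⟨⟨n, hn⟩, -⟩ := hc
  have h1 : 4 * (d - P) ≤ 3 * P := dejeanWord_run_le (n := n) hP fun j hj => by
    rw [hn j (by omega), Nat.add_assoc, hn (j + P) (by omega), ← Nat.add_assoc, hu]
  have h2 : 4 * d ≤ 7 * P := by omega
  have h3 : (4 * d : ℝ) ≤ 7 * P := by exact_mod_cast h2
  rw [List.sum_singleton]
  linarith

theorem isRT_even (k : ℕ) :
    IsRT (2 * k + 2) 3 (3 * ((2 * k + 2 : ℕ) : ℝ) / 2 + 1 / 4) := by
  refine isRT_of_bounds (isPlusFree_of_val (blockWord_lt 190 evenBlocks) ?_)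
    fun v s h => (hasPair_ternary v).le h
  intro P u s ds hP hu hds hc
  have h1 : 4 * ds.sum ≤ (12 * (k + 1) + 1) * P :=
    classified_even.even_bound (List.all_eq_true.1 even_potentialCheck) hP hu
      (by rw [hds]; ring) hc
  generalize ds.sum = S at h1 ⊢
  have h2 : (4 * (S : ℝ)) ≤ (12 * (k + 1) + 1) * P := by exact_mod_cast h1
  push_cast
  linarith

theorem isRT_odd (k : ℕ) :
    IsRT (2 * k + 3) 3 (3 * ((2 * k + 3 : ℕ) : ℝ) / 2 + 1 / 6) := by
  refine isRT_of_bounds (isPlusFree_of_val (blockWord_lt 386 oddBlocks) ?_)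
    fun v s h => (hasSandwich_ternary v).le (k := k + 1) h
  intro P u s ds hP hu hds hc
  have h1 : 6 * ds.sum ≤ (18 * k + 28) * P :=
    classified_odd.odd_bound (List.all_eq_true.1 odd_potentialCheck) hP hu hds hc
  generalize ds.sum = S at h1 ⊢
  have h2 : (6 * (S : ℝ)) ≤ (18 * k + 28) * P := by exact_mod_cast h1
  push_cast
  linarith

theorem theorem1 (i : ℕ) (hi : 1 ≤ i) :
    ((i = 1 ∨ Even i) → IsRT i 3 (3 * (i : ℝ) / 2 + 1 / 4)) ∧
    ((Odd i ∧ 3 ≤ i) → IsRT i 3 (3 * (i : ℝ) / 2 + 1 / 6)) := by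
  refine ⟨?_, ?_⟩
  · rintro (rfl | ⟨k, rfl⟩)
    · convert isRT_one using 1
      norm_num
    · obtain ⟨k, rfl⟩ : ∃ k', k = k' + 1 := ⟨k - 1, by omega⟩
      rw [show k + 1 + (k + 1) = 2 * k + 2 by ring]
      exact isRT_even k
  · rintro ⟨⟨k, rfl⟩, h3⟩
    obtain ⟨k, rfl⟩ : ∃ k', k = k' + 1 := ⟨k - 1, by omega⟩
    rw [show 2 * (k + 1) + 1 = 2 * k + 3 by ring]
    exact isRT_odd k
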